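/- Let $n\ge 1$ and let $x_1,\dots,x_n$ be positive real numbers. For $I\subset\{1,\dots,n\}$ put $x_I=\sum_{i\in I}x_i$. Let $\zeta(z)=e^{z/2}-e^{-z/2}$, let $P_1(a_1;x_1)=1/x_1$ and, for $n\ge 2$, \[ P_n(a_1,\dots,a_n;x_1,\dots,x_n)=\sum_{\substack{\tau\in S_n\\ \tau(1)=1}}\frac{\prod_{j=2}^{n-1}x_{\tau(j)}\ \prod_{j=1}^{n-1}\zeta\Bigl(\bigl(\sum_{k=1}^{j}a_{\tau(k)}\bigr)x_{\tau(j+1)}-a_{\tau(j+1)}\bigl(\sum_{k=1}^{j}x_{\tau(k)}\bigr)\Bigr)}{\prod_{j=1}^{n-1}\bigl(a_{\tau(j)}x_{\tau(j+1)}-a_{\tau(j+1)}x_{\tau(j)}\bigr)} , \] and define \[ \mathcal F_n^{\mathsf{Bur}}(x_1,\dots,x_n)=\frac{e^{(\sum_{j=1}^n x_j)^3/24}}{\bigl(\sum_{j=1}^n x_j\bigr)\prod_{j=1}^n\sqrt{2\pi x_j}}\int_{\mathbb R^n}\Bigl[\prod_{j=1}^n e^{-\frac{a_j^2}{2x_j}}\,da_j\Bigr]\,P_n(\mathsf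 i a_1,\dots,\mathsf i a_n;x_1,\dots,x_n). \] For $\ell\ge 1$ and $y_1,\dots,y_\ell>0$ define \[ \mathcal E(y_1,\dots,y_\ell)=\frac{e^{(\sum_{j=1}^\ell y_j^3)/12}}{\prod_{j=1}^\ell\sqrt{4\pi y_j}}\int_{\mathbb R_{\ge0}^\ell}\Bigl[\prod_{j=1}^\ell ds_j\Bigr]\exp\Bigl(-\sum_{j=1}^\ell\Bigl(\frac{(s_j-s_{j+1})^2}{4y_j}+\frac{(s_j+s_{j+1})y_j}{2}\Bigr)\Bigr),\qquad s_{\ell+1}=s_1 , \] \[ \mathcal C(y_1,\dots,y_\ell)=\frac{e^{\frac1{24}\sum_{j=1}^\ell y_j^3}}{(2\pi)^\ell}\int_{\mathbb R^\ell}\frac{\prod_{j=1}^\ell e^{-\frac{f_j^2}{2y_j}}\frac{df_j}{y_j}}{\prod_{j=1}^\ell\Bigl[\mathsf i\Bigl(\frac{f_j}{y_j}-\frac{f_{j+1}}{y_{j+1}}\Bigr)-\frac{y_j+y_{j+1}}2\Bigr]},\qquad f_{\ell+1}=f_1,\ y_{\ell+1}=y_1 . \] A cyclically ordered partition $[I_1\sqcup\cdots\sqcup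 I_\ell]$ of $\{1,\dots,n\}$ is an ordered partition into $\ell$ nonempty blocks, considered up to the identification of $[I_1\sqcup\cdots\sqcup I_\ell]$ with $[I_2\sqcup\cdots\sqcup I_\ell\sqcup I_1]$; the number $\mathcal C(x_{I_1},\dots,x_{I_\ell})$ depends only on this class. Then: (1) The integral defining $\mathcal F_n^{\mathsf{Bur}}$ converges absolutely, and \[ \mathcal F_n^{\mathsf{Bur}}(x_1,\dots,x_n)=\frac{(2\pi)^{n/2}}{\prod_{j=1}^n x_j^{1/2}}\ \sum_{\ell=1}^n\ \sum_{[I_1\sqcup\cdots\sqcup I_\ell]=\{1,\dots,n\}}-\,\mathcal C(x_{I_1},\dots,x_{I_\ell}), \] where the inner sum runs over the cyclically ordered partitions of $\{1,\dots,n\}$ into $\ell$ blocks. (2) For every cyclically ordered partition $[I_1\sqcup\cdots\sqcup I_\ell]$ of $\{1,\dots,n\}$, the integrals below converge absolutely, and \[ \mathcal C(x_{I_1},\dots,x_{I_\ell})=(-1)^\ell\,\mathcal E\Bigl(\frac{x_{I_1}}{2^{1/3}},\dots,\frac{x_{I_\ell}}{2^{1/3}}\Bigr). \] -/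

import Mathlib

open MeasureTheory

noncomputable section

/-! ### Buryak's formula -/

/-- `ζ(z) = e^{z/2} - e^{-z/2}`. -/
def buryakZeta (z : ℂ) : ℂ :=
  Complex.exp (z / 2) - Complex.exp (-z / 2)

/-- The function `P_n(a_1, …, a_n; x_1, …, x_n)`, with indices starting at `0`. For `n ≥ 2` it is
given by a sum of fractions, whose denominators vanish only on finitely many hyperplanes in `a`
when the `x_j` are nonzero. The value for `n = 0` plays no role. -/
def buryakP : (n : ℕ) → (Fin n → ℂ) → (Fin n → ℂ) → ℂ
  | 0, _, _ => 0
  | 1, _, x => 1 / x 0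
  | m + 2, a, x =>
    ∑ τ : Equiv.Perm (Fin (m + 2)) with τ 0 = 0,
      ((∏ j ∈ Finset.Ioo 0 (Fin.last (m + 1)), x (τ j)) *
        ∏ j : Fin (m + 1),
          buryakZeta
            ((∑ k ∈ Finset.Iic j.castSucc, a (τ k)) * x (τ j.succ) -
              a (τ j.succ) * ∑ k ∈ Finset.Iic j.castSucc, x (τ k))) /
      ∏ j : Fin (m + 1),
        (a (τ j.castSucc) * x (τ j.succ) - a (τ j.succ) * x (τ j.castSucc))

/-- The integrand `∏_j e^{-a_j²/(2x_j)} · P_n(i a_1, …, i a_n; x_1, …, x_n)`. -/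
def buryakIntegrand (n : ℕ) (x a : Fin n → ℝ) : ℂ :=
  ((∏ j, Real.exp (-(a j) ^ 2 / (2 * x j)) : ℝ) : ℂ) *
    buryakP n (fun j => Complex.I * (a j : ℂ)) (fun j => (x j : ℂ))

/-- Buryak's `n`-point function. -/
def buryakF (n : ℕ) (x : Fin n → ℝ) : ℂ :=
  ((Real.exp ((∑ j, x j) ^ 3 / 24) /
      ((∑ j, x j) * ∏ j, Real.sqrt (2 * Real.pi * x j)) : ℝ) : ℂ) *
    ∫ a : Fin n → ℝ, buryakIntegrand n x a

/-! ### Okounkov's function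

Indices in `Fin ℓ` are cyclic: the successor of `j` is `finRotate ℓ j`. -/

/-- The integrand `exp(-∑_j ((s_j - s_{j+1})²/(4x_j) + (s_j + s_{j+1}) x_j/2))`. -/
def okounkovIntegrand {ℓ : ℕ} (x s : Fin ℓ → ℝ) : ℝ :=
  Real.exp (-∑ j, ((s j - s (finRotate ℓ j)) ^ 2 / (4 * x j) +
    (s j + s (finRotate ℓ j)) * x j / 2))

/-- The function `𝓔(x_1, …, x_ℓ)`. -/
def okounkovE {ℓ : ℕ} (x : Fin ℓ → ℝ) : ℝ :=
  Real.exp ((∑ j, x j ^ 3) / 12) / (∏ j, Real.sqrt (4 * Real.pi * x j)) *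
    ∫ s in {s : Fin ℓ → ℝ | ∀ j, 0 ≤ s j}, okounkovIntegrand x s

/-! ### The cyclic Gaussian integrals -/

/-- The integrand
`∏_j e^{-f_j²/(2y_j)} / y_j / ∏_j (i (f_j/y_j - f_{j+1}/y_{j+1}) - (y_j + y_{j+1})/2)`. -/
def cyclicIntegrand {ℓ : ℕ} (y f : Fin ℓ → ℝ) : ℂ :=
  ((∏ j, Real.exp (-(f j) ^ 2 / (2 * y j)) / y j : ℝ) : ℂ) /
    ∏ j, (Complex.I * ((f j / y j - f (finRotate ℓ j) / y (finRotate ℓ j) : ℝ) : ℂ) -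
      (((y j + y (finRotate ℓ j)) / 2 : ℝ) : ℂ))

/-- `e^{∑ y_j³/24} / (2π)^ℓ` times the integral over `ℝ^ℓ` of the cyclic integrand. -/
def cyclicIntegral {ℓ : ℕ} (y : Fin ℓ → ℝ) : ℂ :=
  ((Real.exp ((∑ j, y j ^ 3) / 24) / (2 * Real.pi) ^ ℓ : ℝ) : ℂ) *
    ∫ f : Fin ℓ → ℝ, cyclicIntegrand y f

/-! ### Ordered and cyclically ordered set partitions -/

/-- Ordered partitions `I_1 ⊔ … ⊔ I_ℓ` of an `n`-element set into `ℓ` nonempty blocks. -/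
def OrderedSetPartition (n ℓ : ℕ) : Type :=
  {I : Fin ℓ → Finset (Fin n) //
    (∀ j, (I j).Nonempty) ∧ (∀ j k, j ≠ k → Disjoint (I j) (I k)) ∧
      ∀ i, ∃ j, i ∈ I j}

/-- The block sums `x_{I_j} = ∑_{i ∈ I_j} x_i`. -/
def OrderedSetPartition.blockSum {n ℓ : ℕ} (I : OrderedSetPartition n ℓ) (x : Fin n → ℝ) :
    Fin ℓ → ℝ :=
  fun j => ∑ i ∈ I.1 j, x i

/-- Two ordered partitions are identified when they differ by a rotation of the blocks. -/
instance OrderedSetPartition.rotationSetoid (n ℓ : ℕ) : Setoid (OrderedSetPartition n ℓ) where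
  r I I' := ∃ m : ℕ, ∀ j, I'.1 j = I.1 ((finRotate ℓ ^ m) j)
  iseqv :=
    { refl := fun _ => ⟨0, fun _ => rfl⟩
      symm := by
        rintro I I' ⟨m, hm⟩
        have hpos : 0 < orderOf (finRotate ℓ) := orderOf_pos _
        refine ⟨m * (orderOf (finRotate ℓ) - 1), fun j => ?_⟩
        rw [hm, ← Equiv.Perm.mul_apply, ← pow_add]
        have : m + m * (orderOf (finRotate ℓ) - 1) = orderOf (finRotate ℓ) * m := by
          obtain ⟨k, hk⟩ : ∃ k, orderOf (finRotate ℓ) = k + 1 := ⟨_, (Nat.sub_add_cancel hpos).symm⟩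
          rw [hk, Nat.add_sub_cancel]
          ring
        rw [this, pow_mul, pow_orderOf_eq_one, one_pow, Equiv.Perm.one_apply]
      trans := by
        rintro I I' I'' ⟨m, hm⟩ ⟨k, hk⟩
        refine ⟨m + k, fun j => ?_⟩
        rw [hk, hm, pow_add, Equiv.Perm.mul_apply] }

/-- Cyclically ordered partitions `[I_1 ⊔ … ⊔ I_ℓ]` of an `n`-element set. -/
def CyclicSetPartition (n ℓ : ℕ) : Type :=
  Quotient (OrderedSetPartition.rotationSetoid n ℓ)

open Classical in
instance OrderedSetPartition.instFintype (n ℓ : ℕ) : Fintype (OrderedSetPartition n ℓ) :=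
  inferInstanceAs (Fintype {I : Fin ℓ → Finset (Fin n) //
    (∀ j, (I j).Nonempty) ∧ (∀ j k, j ≠ k → Disjoint (I j) (I k)) ∧
      ∀ i, ∃ j, i ∈ I j})

open Classical in
instance CyclicSetPartition.instFintype (n ℓ : ℕ) : Fintype (CyclicSetPartition n ℓ) :=
  inferInstanceAs (Fintype (Quotient (OrderedSetPartition.rotationSetoid n ℓ)))

theorem cyclicIntegral_rotate {ℓ : ℕ} (y : Fin ℓ → ℝ) (m : ℕ) :
    cyclicIntegral (fun j => y ((finRotate ℓ ^ m) j)) = cyclicIntegral y := by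
  set ρ : Equiv.Perm (Fin ℓ) := finRotate ℓ ^ m with hρ
  have hcomm : ∀ j, ρ (finRotate ℓ j) = finRotate ℓ (ρ j) := by
    intro j
    rw [hρ, ← Equiv.Perm.mul_apply, ← Equiv.Perm.mul_apply, ← pow_succ, ← pow_succ']
  have hmp := volume_measurePreserving_piCongrLeft (fun _ : Fin ℓ => ℝ) ρ.symm
  have hint : ∫ f : Fin ℓ → ℝ, cyclicIntegrand (fun j => y (ρ j)) f
      = ∫ f : Fin ℓ → ℝ, cyclicIntegrand y f := by
    rw [← hmp.integral_comp' (g := cyclicIntegrand (fun j => y (ρ j)))]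
    congr 1
    funext f
    have hf : ∀ j, (MeasurableEquiv.piCongrLeft (fun _ : Fin ℓ => ℝ) ρ.symm) f j = f (ρ j) := by
      intro j
      have := Equiv.piCongrLeft_apply_apply (fun _ : Fin ℓ => ℝ) ρ.symm f (ρ j)
      simp only [Equiv.symm_apply_apply] at this
      exact this
    simp only [cyclicIntegrand, hf, hcomm]
    congr 1
    · rw [Equiv.prod_comp ρ (fun j => Real.exp (-(f j) ^ 2 / (2 * y j)) / y j)]
    · exact Equiv.prod_comp ρ (fun j =>
        (Complex.I * ((f j / y j - f (finRotate ℓ j) / y (finRotate ℓ j) : ℝ) : ℂ) -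
          (((y j + y (finRotate ℓ j)) / 2 : ℝ) : ℂ)))
  have hsum : ∑ j, y (ρ j) ^ 3 = ∑ j, y j ^ 3 := Equiv.sum_comp ρ (fun j => y j ^ 3)
  simp only [cyclicIntegral, hint, hsum]

/-- The cyclic Gaussian integral attached to a cyclically ordered partition: its value at the block
sums `x_{I_1}, …, x_{I_ℓ}` of any representative. -/
def CyclicSetPartition.integral {n ℓ : ℕ} (x : Fin n → ℝ) (c : CyclicSetPartition n ℓ) : ℂ :=
  Quotient.lift (fun I : OrderedSetPartition n ℓ => cyclicIntegral (I.blockSum x))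
    (by
      rintro I I' ⟨m, hm⟩
      have h : I'.blockSum x = fun j => I.blockSum x ((finRotate ℓ ^ m) j) := by
        funext j
        simp only [OrderedSetPartition.blockSum, hm]
      show cyclicIntegral (I.blockSum x) = cyclicIntegral (I'.blockSum x)
      rw [h, cyclicIntegral_rotate]) c

end

/-!
Put `z_j = i a_j / x_j`. Each `ζ`-factor of `P_n` is a difference of two exponentials; expanding
the product turns the sum over `τ` with `τ(1) = 1` into a sum over words in which the letter `1`
may stand anywhere, and shuffle relations between the chains of fractions
`∏ 1 / (z_{τ(j)} - z_{τ(j+1)})` rewrite `P_n(i a; x)` as a sum over all orderings of the indices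
of `exp (∑ ω(j, k))`, over `j` before `k`, times one chain, with `ω` antisymmetric. The poles of
the single terms cancel, so that the sum is bounded. By dominated convergence its Gaussian
integral is the limit `ε → 0` of the integral with `z_j` replaced by `z_j + ε j`. There the terms
can be integrated separately: each fraction is the Laplace transform of a half line, and the
Gaussian integral over `a` leaves an integral over closed paths `0, s_1, …, s_{n-1}, 0` of Airy
heat kernels `K_{x_j}`, where `s_k` runs over a half line whose side and sign depend on whether
the ordering ascends or descends at `k`.

The difference of the two signed half-line weights is Lebesgue measure, so the semigroup law
`∫ K_x(r, s) K_y(s, t) ds = K_{x+y}(r, t)` merges indices into blocks, and the sum over orderings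
becomes a sum over ordered set partitions with all `s_k ≥ 0`.

On the other side, the cyclic factors `i (f_j/y_j - f_{j+1}/y_{j+1}) - (y_j + y_{j+1})/2`
telescope to the constant `-∑ y_j`. Multiplying the cyclic integral by it cuts the cycle open at
each position in turn, and the Laplace transform identifies the pieces with the same integrals
over paths from `0` to `0`. Transforming all factors of the cyclic integral at once gives the
integral over `s ∈ [0, ∞)^ℓ` of a cyclic product of Airy heat kernels, and the substitution
`s ↦ 2^{1/3} s` gives Okounkov's function.
-/

noncomputable section

open Filter Topology
open scoped Matrix Pointwise

/-! ### The Airy heat kernel -/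

/-- The heat kernel `K_x(r, s)` of the Airy operator `d²/ds² / 2 - s`: the propagator on the line
of Brownian motion for time `x` in a linear potential. -/
def airyKernel (x r s : ℝ) : ℝ :=
  Real.exp (x ^ 3 / 24) / Real.sqrt (2 * Real.pi * x) *
    Real.exp (-(r - s) ^ 2 / (2 * x) - (r + s) * x / 2)

theorem airyKernel_nonneg (x r s : ℝ) : 0 ≤ airyKernel x r s := by
  unfold airyKernel; positivity

@[fun_prop]
theorem measurable_airyKernel {α : Type*} [MeasurableSpace α] (x : ℝ) {f g : α → ℝ}
    (hf : Measurable f) (hg : Measurable g) : Measurable fun a => airyKernel x (f a) (g a) := by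
  unfold airyKernel; fun_prop

/-- Completing the square in the intermediate point `s`. -/
theorem airyKernel_mul {x y : ℝ} (hx : 0 < x) (hy : 0 < y) (r s t : ℝ) :
    airyKernel x r s * airyKernel y s t =
      airyKernel (x + y) r t * (Real.sqrt ((x + y) / (2 * Real.pi * x * y)) *
        Real.exp (-((x + y) / (2 * x * y)) *
          (s - (r * y + t * x - x * y * (x + y) / 2) / (x + y)) ^ 2)) := by
  have hsqrt : (Real.sqrt (2 * Real.pi * x))⁻¹ * (Real.sqrt (2 * Real.pi * y))⁻¹ =
      (Real.sqrt (2 * Real.pi * (x + y)))⁻¹ * Real.sqrt ((x + y) / (2 * Real.pi * x * y)) := by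
    rw [← Real.sqrt_inv, ← Real.sqrt_inv, ← Real.sqrt_inv, ← Real.sqrt_mul (by positivity),
      ← Real.sqrt_mul (by positivity)]
    congr 1
    field_simp
  have hexp : x ^ 3 / 24 + y ^ 3 / 24 + (-(r - s) ^ 2 / (2 * x) - (r + s) * x / 2) +
        (-(s - t) ^ 2 / (2 * y) - (s + t) * y / 2) =
      (x + y) ^ 3 / 24 + (-(r - t) ^ 2 / (2 * (x + y)) - (r + t) * (x + y) / 2) +
        -((x + y) / (2 * x * y)) *
          (s - (r * y + t * x - x * y * (x + y) / 2) / (x + y)) ^ 2 := by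
    field_simp
    ring
  calc airyKernel x r s * airyKernel y s t
      = ((Real.sqrt (2 * Real.pi * x))⁻¹ * (Real.sqrt (2 * Real.pi * y))⁻¹) *
          Real.exp (x ^ 3 / 24 + y ^ 3 / 24 + (-(r - s) ^ 2 / (2 * x) - (r + s) * x / 2) +
            (-(s - t) ^ 2 / (2 * y) - (s + t) * y / 2)) := by
        simp only [airyKernel, Real.exp_add]
        ring
    _ = _ := by
        rw [hsqrt, hexp]
        simp only [airyKernel, Real.exp_add]
        ring

theorem integrable_airyKernel_mul {x y : ℝ} (hx : 0 < x) (hy : 0 < y) (r t : ℝ) :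
    Integrable fun s => airyKernel x r s * airyKernel y s t := by
  simp_rw [airyKernel_mul hx hy]
  have h := (integrable_exp_neg_mul_sq (b := (x + y) / (2 * x * y)) (by positivity)).comp_sub_right
    ((r * y + t * x - x * y * (x + y) / 2) / (x + y))
  exact (h.const_mul _).const_mul _

theorem integral_airyKernel_mul {x y : ℝ} (hx : 0 < x) (hy : 0 < y) (r t : ℝ) :
    ∫ s, airyKernel x r s * airyKernel y s t = airyKernel (x + y) r t := by
  have hone : (x + y) / (2 * Real.pi * x * y) * (Real.pi / ((x + y) / (2 * x * y))) = 1 := by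
    field_simp
  simp_rw [airyKernel_mul hx hy]
  rw [integral_const_mul, integral_const_mul,
    integral_sub_right_eq_self (fun s => Real.exp (-((x + y) / (2 * x * y)) * s ^ 2)),
    integral_gaussian, ← Real.sqrt_mul (by positivity), hone, Real.sqrt_one, mul_one]

/-! ### Iterated integrals along a path -/

/-- A measurable weight with values in `[-1, 1]`; inserting such weights between Airy kernels
does not affect integrability. -/
structure IsUnitWeight (w : ℝ → ℝ) : Prop where
  measurable : Measurable w
  abs_le_one : ∀ s, |w s| ≤ 1

theorem IsUnitWeight.abs {w : ℝ → ℝ} (hw : IsUnitWeight w) : IsUnitWeight fun s => |w s| where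
  measurable := hw.measurable.abs
  abs_le_one s := by simpa only [abs_abs] using hw.abs_le_one s

theorem IsUnitWeight.norm_mul_airyKernel_mul_le {w : ℝ → ℝ} (hw : IsUnitWeight w) {p q : ℝ}
    (hpq : |p| ≤ q) (x r s : ℝ) : ‖w s * (airyKernel x r s * p)‖ ≤ airyKernel x r s * q := by
  have hK := airyKernel_nonneg x r s
  calc ‖w s * (airyKernel x r s * p)‖ = |w s| * (airyKernel x r s * |p|) := by
        rw [Real.norm_eq_abs, abs_mul, abs_mul, abs_of_nonneg hK]
    _ ≤ 1 * (airyKernel x r s * q) := by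
        gcongr
        exact hw.abs_le_one s
    _ = airyKernel x r s * q := one_mul _

section Path

variable {ι : Type*} (x : ι → ℝ) (h : ι → ι → ℝ → ℝ)

/-- For a list `i₀, …, i_m`, the iterated integral of
`K_{x_{i₀}}(r, s₁) h_{i₀ i₁}(s₁) K_{x_{i₁}}(s₁, s₂) ⋯ K_{x_{i_m}}(s_m, 0)` over `s₁, …, s_m`. -/
def pathIntegral : List ι → ℝ → ℝ
  | [], _ => 0
  | [i], r => airyKernel (x i) r 0
  | i :: j :: l, r => ∫ s, h i j s * (airyKernel (x i) r s * pathIntegral (j :: l) s)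

variable {x h}

theorem sum_map_cons_pos (hx : ∀ i, 0 < x i) (i : ι) (l : List ι) : 0 < ((i :: l).map x).sum :=
  List.sum_pos _ (by simpa using ⟨hx i, fun a _ => hx a⟩) (by simp)

theorem measurable_pathIntegral (hh : ∀ i j, IsUnitWeight (h i j)) :
    ∀ l, Measurable (pathIntegral x h l)
  | [] => measurable_const
  | [i] => measurable_airyKernel _ measurable_id measurable_const
  | i :: j :: l => by
    have hl := measurable_pathIntegral hh (j :: l)
    have hw := (hh i j).measurable
    have : Measurable (Function.uncurry fun r s =>
        h i j s * (airyKernel (x i) r s * pathIntegral x h (j :: l) s)) := by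
      unfold Function.uncurry
      fun_prop
    exact this.stronglyMeasurable.integral_prod_right.measurable

/-- The weights only decrease the path integral, and without them it collapses to a single kernel
by the semigroup law. -/
theorem abs_pathIntegral_cons_le (hx : ∀ i, 0 < x i) (hh : ∀ i j, IsUnitWeight (h i j)) (i : ι)
    (l : List ι) (r : ℝ) :
    |pathIntegral x h (i :: l) r| ≤ airyKernel ((i :: l).map x).sum r 0 := by
  induction l generalizing i r with
  | nil => simp [pathIntegral, abs_of_nonneg (airyKernel_nonneg _ _ _)]
  | cons j l ih =>
    rw [pathIntegral, List.map_cons, List.sum_cons,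
      ← integral_airyKernel_mul (hx i) (sum_map_cons_pos hx j l), ← Real.norm_eq_abs]
    exact norm_integral_le_of_norm_le
      (integrable_airyKernel_mul (hx i) (sum_map_cons_pos hx j l) r 0)
      (ae_of_all _ fun s => (hh i j).norm_mul_airyKernel_mul_le (ih j s) _ _ _)

theorem integrable_mul_airyKernel_mul_pathIntegral (hx : ∀ i, 0 < x i)
    (hh : ∀ i j, IsUnitWeight (h i j)) {w : ℝ → ℝ} (hw : IsUnitWeight w) {y : ℝ} (hy : 0 < y)
    (j : ι) (l : List ι) (r : ℝ) :
    Integrable fun s => w s * (airyKernel y r s * pathIntegral x h (j :: l) s) := by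
  have hl := measurable_pathIntegral (x := x) hh (j :: l)
  have hwm := hw.measurable
  exact (integrable_airyKernel_mul hy (sum_map_cons_pos hx j l) r 0).mono' (by fun_prop)
    (ae_of_all _ fun s =>
      hw.norm_mul_airyKernel_mul_le (abs_pathIntegral_cons_le hx hh j l s) _ _ _)

/-- The integrand over `(s₁, …, s_m)` whose iterated integral is `pathIntegral`; the end points of
the path are `s₀ = r` and `s_{m+1} = 0`. -/
def pathIntegrand {m : ℕ} (x : ι → ℝ) (h : ι → ι → ℝ → ℝ) (v : Fin (m + 1) → ι) (r : ℝ)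
    (s : Fin m → ℝ) : ℝ :=
  (∏ k : Fin m, h (v k.castSucc) (v k.succ) (s k)) *
    ∏ k : Fin (m + 1),
      airyKernel (x (v k)) ((Fin.cons r s : Fin (m + 1) → ℝ) k) ((Fin.snoc s 0 : Fin (m + 1) → ℝ) k)

theorem pathIntegrand_of_fin_one (v : Fin 1 → ι) (r : ℝ) :
    pathIntegrand x h v r = fun _ => airyKernel (x (v 0)) r 0 := by
  funext s
  simp [pathIntegrand, Fin.snoc]

theorem pathIntegrand_cons {m : ℕ} (v : Fin (m + 2) → ι) (r s₀ : ℝ) (s : Fin m → ℝ) :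
    pathIntegrand x h v r (Fin.cons s₀ s : Fin (m + 1) → ℝ) =
      h (v 0) (v 1) s₀ * (airyKernel (x (v 0)) r s₀ * pathIntegrand x h (Fin.tail v) s₀ s) := by
  unfold pathIntegrand
  have hs : (Fin.snoc (Fin.cons s₀ s : Fin (m + 1) → ℝ) (0 : ℝ) : Fin (m + 2) → ℝ) =
      Fin.cons s₀ (Fin.snoc s 0 : Fin (m + 1) → ℝ) := (Fin.cons_snoc_eq_snoc_cons s₀ s 0).symm
  rw [Fin.prod_univ_succ, Fin.prod_univ_succ (n := m + 1), hs]
  simp only [Fin.cons_zero, Fin.cons_succ, Fin.castSucc_zero, Fin.succ_zero_eq_one, Fin.tail,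
    Fin.succ_castSucc]
  ring

theorem measurable_pathIntegrand (hh : ∀ i j, IsUnitWeight (h i j)) {m : ℕ}
    (v : Fin (m + 1) → ι) :
    Measurable fun p : ℝ × (Fin m → ℝ) => pathIntegrand x h v p.1 p.2 := by
  unfold pathIntegrand
  refine (Finset.measurable_prod _ fun k _ => (hh _ _).measurable.comp (by fun_prop)).mul
    (Finset.measurable_prod _ fun k _ => measurable_airyKernel _ ?_ ?_)
  · refine Fin.cases ?_ (fun j => ?_) k
    · simpa only [Fin.cons_zero] using measurable_fst
    · simp only [Fin.cons_succ]; fun_prop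
  · refine Fin.lastCases ?_ (fun j => ?_) k
    · simp only [Fin.snoc_last]; fun_prop
    · simp only [Fin.snoc_castSucc]; fun_prop

theorem abs_pathIntegrand {m : ℕ} (v : Fin (m + 1) → ι) (r : ℝ) (s : Fin m → ℝ) :
    |pathIntegrand x h v r s| = pathIntegrand x (fun i j s => |h i j s|) v r s := by
  simp only [pathIntegrand, abs_mul, Finset.abs_prod, abs_of_nonneg (airyKernel_nonneg _ _ _)]

theorem integral_norm_pathIntegrand_step {m : ℕ} (v : Fin (m + 1) → ι)
    (w y r s₀ : ℝ) :
    ∫ s, ‖w * (airyKernel y r s₀ * pathIntegrand x h v s₀ s)‖ =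
      |w| * (airyKernel y r s₀ * ∫ s, pathIntegrand x (fun i j s => |h i j s|) v s₀ s) := by
  simp_rw [norm_mul, Real.norm_eq_abs, abs_pathIntegrand, integral_const_mul,
    abs_of_nonneg (airyKernel_nonneg _ _ _)]

/-- Integrability and the value are proved together: the induction step for integrability uses
the value for the weights `|h i j|`. -/
theorem integrable_and_integral_pathIntegrand (hx : ∀ i, 0 < x i) {m : ℕ}
    (hh : ∀ i j, IsUnitWeight (h i j)) (v : Fin (m + 1) → ι) (r : ℝ) :
    Integrable (pathIntegrand x h v r) ∧
      ∫ s, pathIntegrand x h v r s = pathIntegral x h (List.ofFn v) r := by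
  induction m generalizing h r with
  | zero =>
    rw [pathIntegrand_of_fin_one]
    exact ⟨integrable_const _, by simp [pathIntegral, measureReal_def, volume_pi]⟩
  | succ m ih =>
    let e := (MeasurableEquiv.piFinSuccAbove (fun _ : Fin (m + 1) => ℝ) 0).symm
    have he : MeasurePreserving e :=
      (volume_preserving_piFinSuccAbove (fun _ : Fin (m + 1) => ℝ) 0).symm
    have hcons : ∀ p : ℝ × (Fin m → ℝ), pathIntegrand x h v r (e p) =
        h (v 0) (v 1) p.1 * (airyKernel (x (v 0)) r p.1 *
          pathIntegrand x h (Fin.tail v) p.1 p.2) := fun p => by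
      rw [← pathIntegrand_cons]
      exact congrArg _ (Fin.insertNth_zero' p.1 p.2)
    have hw := (hh (v 0) (v 1)).measurable
    have hmeas := measurable_pathIntegrand (x := x) hh (Fin.tail v)
    have habs : ∀ i j, IsUnitWeight fun s => |h i j s| := fun i j => (hh i j).abs
    have hint : Integrable fun p : ℝ × (Fin m → ℝ) => h (v 0) (v 1) p.1 *
        (airyKernel (x (v 0)) r p.1 * pathIntegrand x h (Fin.tail v) p.1 p.2) := by
      refine (integrable_prod_iff (by fun_prop)).2 ⟨ae_of_all _ fun s₀ =>
        ((ih hh (Fin.tail v) s₀).1.const_mul (airyKernel (x (v 0)) r s₀)).const_mul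
          (h (v 0) (v 1) s₀), ?_⟩
      simp_rw [integral_norm_pathIntegrand_step, fun s₀ => (ih habs (Fin.tail v) s₀).2,
        List.ofFn_succ]
      exact integrable_mul_airyKernel_mul_pathIntegral hx habs (habs _ _) (hx _) _ _ r
    refine ⟨(he.integrable_comp_emb e.measurableEmbedding).1
      (hint.congr (ae_of_all _ fun p => (hcons p).symm)), ?_⟩
    rw [← he.integral_comp', funext hcons, Measure.volume_eq_prod, integral_prod _ hint]
    simp_rw [integral_const_mul, (ih hh (Fin.tail v) _).2]
    simp only [List.ofFn_succ, Fin.tail, pathIntegral, Fin.succ_zero_eq_one]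

end Path

/-! ### Gaussian integrals of products of simple fractions -/

/-- The weight with `∫ halfLineWeight δ s * e^{s z} ds = 1 / z` when `Re z = δ ≠ 0`. -/
def halfLineWeight (δ : ℝ) : ℝ → ℝ :=
  if δ < 0 then (Set.Ici 0).indicator fun _ => -1 else (Set.Iic 0).indicator fun _ => 1

theorem halfLineWeight_of_neg {δ : ℝ} (hδ : δ < 0) :
    halfLineWeight δ = (Set.Ici 0).indicator fun _ => -1 :=
  if_pos hδ

theorem halfLineWeight_of_pos {δ : ℝ} (hδ : 0 < δ) :
    halfLineWeight δ = (Set.Iic 0).indicator fun _ => 1 :=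
  if_neg hδ.not_gt

theorem isUnitWeight_halfLineWeight (δ : ℝ) : IsUnitWeight (halfLineWeight δ) where
  measurable := by
    unfold halfLineWeight
    split_ifs
    · exact measurable_const.indicator measurableSet_Ici
    · exact measurable_const.indicator measurableSet_Iic
  abs_le_one s := by
    unfold halfLineWeight
    split_ifs <;> by_cases hs : 0 ≤ s <;> by_cases hs' : s ≤ 0 <;> simp [hs, hs']

@[fun_prop]
theorem measurable_halfLineWeight (δ : ℝ) : Measurable (halfLineWeight δ) :=
  (isUnitWeight_halfLineWeight δ).measurable

theorem halfLineWeight_const_mul {ε : ℝ} (hε : 0 < ε) (δ : ℝ) :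
    halfLineWeight (ε * δ) = halfLineWeight δ := by
  simp only [halfLineWeight, mul_neg_iff, hε, hε.not_gt, true_and, false_and, or_false]

theorem abs_halfLineWeight_mul_exp_le (δ s : ℝ) :
    |halfLineWeight δ s * Real.exp (s * δ)| ≤ |halfLineWeight δ s| := by
  unfold halfLineWeight
  split_ifs with hδ
  · by_cases hs : 0 ≤ s
    · simpa [hs] using mul_nonpos_of_nonneg_of_nonpos hs hδ.le
    · simp [hs]
  · by_cases hs : s ≤ 0
    · simpa [hs] using mul_nonpos_of_nonpos_of_nonneg hs (not_lt.1 hδ)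
    · simp [hs]

theorem halfLineWeight_mul_cexp_of_neg {δ : ℝ} (hδ : δ < 0) (z : ℂ) :
    (fun s : ℝ => (halfLineWeight δ s : ℂ) * Complex.exp (s * z)) =
      (Set.Ici 0).indicator fun s : ℝ => -Complex.exp (z * s) := by
  funext s
  rw [halfLineWeight_of_neg hδ]
  by_cases hs : 0 ≤ s <;> simp [Set.indicator, hs, mul_comm]

theorem halfLineWeight_mul_cexp_of_pos {δ : ℝ} (hδ : 0 < δ) (z : ℂ) :
    (fun s : ℝ => (halfLineWeight δ s : ℂ) * Complex.exp (s * z)) =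
      (Set.Iic 0).indicator fun s : ℝ => Complex.exp (z * s) := by
  funext s
  rw [halfLineWeight_of_pos hδ]
  by_cases hs : s ≤ 0 <;> simp [Set.indicator, hs, mul_comm]

theorem integrable_halfLineWeight_mul_cexp {z : ℂ} (hz : z.re ≠ 0) :
    Integrable fun s : ℝ => (halfLineWeight z.re s : ℂ) * Complex.exp (s * z) := by
  rcases hz.lt_or_gt with hneg | hpos
  · rw [halfLineWeight_mul_cexp_of_neg hneg, integrable_indicator_iff measurableSet_Ici,
      integrableOn_Ici_iff_integrableOn_Ioi]
    exact (integrableOn_exp_mul_complex_Ioi hneg 0).neg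
  · rw [halfLineWeight_mul_cexp_of_pos hpos, integrable_indicator_iff measurableSet_Iic]
    exact integrableOn_exp_mul_complex_Iic hpos 0

theorem integral_halfLineWeight_mul_cexp {z : ℂ} (hz : z.re ≠ 0) :
    ∫ s : ℝ, (halfLineWeight z.re s : ℂ) * Complex.exp (s * z) = z⁻¹ := by
  rcases hz.lt_or_gt with hneg | hpos
  · rw [halfLineWeight_mul_cexp_of_neg hneg, integral_indicator measurableSet_Ici,
      integral_Ici_eq_integral_Ioi, integral_neg, integral_exp_mul_complex_Ioi hneg]
    simp [neg_div]
  · rw [halfLineWeight_mul_cexp_of_pos hpos, integral_indicator measurableSet_Iic,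
      integral_exp_mul_complex_Iic hpos]
    simp

theorem integrable_exp_neg_sq_div {x : ℝ} (hx : 0 < x) :
    Integrable fun a : ℝ => Real.exp (-a ^ 2 / (2 * x)) := by
  convert integrable_exp_neg_mul_sq (b := 1 / (2 * x)) (by positivity) using 3
  ring

theorem integral_exp_neg_sq_div_mul_cexp {x : ℝ} (hx : 0 < x) (c : ℝ) :
    ∫ a : ℝ, (Real.exp (-a ^ 2 / (2 * x)) : ℂ) * Complex.exp (Complex.I * c * a) =
      (Real.sqrt (2 * Real.pi * x) * Real.exp (-x * c ^ 2 / 2) : ℝ) := by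
  have hx' : (x : ℂ) ≠ 0 := by exact_mod_cast hx.ne'
  have hsqrt : ((Real.pi : ℂ) / (1 / (2 * x))) ^ (1 / 2 : ℂ) =
      (Real.sqrt (2 * Real.pi * x) : ℂ) := by
    rw [Real.sqrt_eq_rpow, Complex.ofReal_cpow (by positivity)]
    push_cast
    congr 1
    field_simp
  calc _ = ∫ a : ℝ, Complex.exp (Complex.I * c * a) * Complex.exp (-(1 / (2 * x)) * a ^ 2) := by
        refine integral_congr_ae (ae_of_all _ fun a => ?_)
        simp only [mul_comm (Complex.exp (Complex.I * c * a))]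
        push_cast
        congr 2
        field_simp
    _ = _ := fourierIntegral_gaussian (by norm_cast; positivity) c
    _ = _ := by
        rw [hsqrt]
        push_cast
        congr 2
        field_simp
        norm_num

section Fourier

variable {ι κ : Type*} [Fintype ι] [Fintype κ] {x : ι → ℝ} (c : ι → ℝ) (M : Matrix κ ι ℝ)
  {δ : κ → ℝ}

/-- The unnormalized density of independent centred Gaussian variables `a_j` of variance `x_j`. -/
def gaussianWeight (x a : ι → ℝ) : ℝ := ∏ j, Real.exp (-(a j) ^ 2 / (2 * x j))

@[fun_prop]
theorem measurable_gaussianWeight (x : ι → ℝ) : Measurable (gaussianWeight x) := by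
  unfold gaussianWeight; fun_prop

theorem integrable_gaussianWeight (hx : ∀ j, 0 < x j) : Integrable (gaussianWeight x) :=
  Integrable.fintype_prod (f := fun j (a : ℝ) => Real.exp (-a ^ 2 / (2 * x j)))
    fun j => integrable_exp_neg_sq_div (hx j)

theorem gaussianWeight_comp_perm (x a : ι → ℝ) (σ : Equiv.Perm ι) :
    gaussianWeight (x ∘ σ) (a ∘ σ) = gaussianWeight x a :=
  Equiv.prod_comp σ fun j => Real.exp (-(a j) ^ 2 / (2 * x j))

/-- A Gaussian density times a plane wave and a product of simple fractions in linear forms of the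
Gaussian variables, the real parts `δ_q` keeping the fractions away from their poles. -/
def gaussianFractions (x c : ι → ℝ) (M : Matrix κ ι ℝ) (δ : κ → ℝ) (a : ι → ℝ) : ℂ :=
  gaussianWeight x a * Complex.exp (Complex.I * (c ⬝ᵥ a : ℝ)) *
    ∏ q, (Complex.I * ((M *ᵥ a) q : ℝ) + δ q)⁻¹

/-- The integrand obtained from `gaussianFractions` by writing each fraction as a Laplace integral
over an auxiliary variable `s_q`. -/
def gaussianLaplace (x c : ι → ℝ) (M : Matrix κ ι ℝ) (δ : κ → ℝ) (a : ι → ℝ) (s : κ → ℝ) : ℂ :=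
  gaussianWeight x a * Complex.exp (Complex.I * (c ⬝ᵥ a : ℝ)) *
    ∏ q, (halfLineWeight (δ q) (s q) : ℂ) *
      Complex.exp ((s q : ℂ) * (Complex.I * ((M *ᵥ a) q : ℝ) + δ q))

theorem integral_gaussianLaplace_right (hδ : ∀ q, δ q ≠ 0) (a : ι → ℝ) :
    ∫ s, gaussianLaplace x c M δ a s = gaussianFractions x c M δ a := by
  unfold gaussianLaplace gaussianFractions
  rw [integral_const_mul, integral_fintype_prod_volume_eq_prod (fun q (s : ℝ) =>
    (halfLineWeight (δ q) s : ℂ) * Complex.exp ((s : ℂ) * (Complex.I * ((M *ᵥ a) q : ℝ) + δ q)))]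
  congr 1
  refine Finset.prod_congr rfl fun q _ => ?_
  have hre : (Complex.I * ((M *ᵥ a) q : ℝ) + δ q).re = δ q := by simp
  simpa only [hre] using integral_halfLineWeight_mul_cexp (hre.trans_ne (hδ q))

theorem gaussianLaplace_eq (a : ι → ℝ) (s : κ → ℝ) :
    gaussianLaplace x c M δ a s =
      ((∏ q, halfLineWeight (δ q) (s q) * Real.exp (s q * δ q) : ℝ) : ℂ) *
        ∏ j, ((Real.exp (-(a j) ^ 2 / (2 * x j)) : ℂ) *
          Complex.exp (Complex.I * ((c + s ᵥ* M) j : ℝ) * a j)) := by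
  have hlin : ∑ q, (s q : ℂ) * (Complex.I * ((M *ᵥ a) q : ℝ)) + Complex.I * (c ⬝ᵥ a : ℝ) =
      ∑ j, Complex.I * ((c + s ᵥ* M) j : ℝ) * a j := by
    have hreal : s ⬝ᵥ (M *ᵥ a) + c ⬝ᵥ a = (c + s ᵥ* M) ⬝ᵥ a := by
      rw [Matrix.dotProduct_mulVec, add_dotProduct, add_comm]
    have := congrArg (fun t : ℝ => Complex.I * (t : ℂ)) hreal
    simp only [dotProduct, Complex.ofReal_add, Complex.ofReal_sum, Complex.ofReal_mul, mul_add,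
      Finset.mul_sum, mul_left_comm Complex.I, mul_assoc] at this ⊢
    exact this
  have hexp := congrArg Complex.exp hlin
  rw [Complex.exp_add] at hexp
  simp only [gaussianLaplace, gaussianWeight, Finset.prod_mul_distrib, Complex.ofReal_prod,
    Complex.ofReal_mul, Complex.ofReal_exp, mul_add, Complex.exp_add, ← Complex.exp_sum, ← hexp]
  ring

theorem integral_gaussianLaplace_left (hx : ∀ j, 0 < x j) (s : κ → ℝ) :
    ∫ a, gaussianLaplace x c M δ a s =
      ((∏ j, Real.sqrt (2 * Real.pi * x j)) *
        ((∏ q, halfLineWeight (δ q) (s q) * Real.exp (s q * δ q)) *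
          ∏ j, Real.exp (-x j * (c + s ᵥ* M) j ^ 2 / 2)) : ℝ) := by
  simp_rw [gaussianLaplace_eq]
  rw [integral_const_mul, integral_fintype_prod_volume_eq_prod (fun j (a : ℝ) =>
    (Real.exp (-a ^ 2 / (2 * x j)) : ℂ) * Complex.exp (Complex.I * ((c + s ᵥ* M) j : ℝ) * a))]
  simp_rw [fun j => integral_exp_neg_sq_div_mul_cexp (hx j) ((c + s ᵥ* M) j)]
  rw [← Complex.ofReal_prod, ← Complex.ofReal_mul, Finset.prod_mul_distrib (s := Finset.univ)
    (f := fun j => Real.sqrt (2 * Real.pi * x j)), mul_left_comm]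

theorem norm_gaussianLaplace (a : ι → ℝ) (s : κ → ℝ) :
    ‖gaussianLaplace x c M δ a s‖ =
      gaussianWeight x a * ∏ q, ‖(halfLineWeight (δ q) (s q) : ℂ) *
        Complex.exp ((s q : ℂ) * (δ q : ℂ))‖ := by
  have hnonneg : 0 ≤ gaussianWeight x a := Finset.prod_nonneg fun _ _ => (Real.exp_pos _).le
  simp [gaussianLaplace, Complex.norm_exp, abs_of_nonneg hnonneg]

theorem integrable_gaussianLaplace (hx : ∀ j, 0 < x j) (hδ : ∀ q, δ q ≠ 0) :
    Integrable fun p : (ι → ℝ) × (κ → ℝ) => gaussianLaplace x c M δ p.1 p.2 := by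
  have hs : Integrable fun s : κ → ℝ => ∏ q, (halfLineWeight (δ q) (s q) : ℂ) *
      Complex.exp ((s q : ℂ) * (δ q : ℂ)) :=
    Integrable.fintype_prod (f := fun q (s : ℝ) => (halfLineWeight (δ q) s : ℂ) *
      Complex.exp ((s : ℂ) * (δ q : ℂ)))
      fun q => integrable_halfLineWeight_mul_cexp (z := (δ q : ℂ)) (hδ q)
  have hmeas : Measurable fun p : (ι → ℝ) × (κ → ℝ) => gaussianLaplace x c M δ p.1 p.2 := by
    unfold gaussianLaplace Matrix.mulVec dotProduct
    fun_prop
  refine ((integrable_gaussianWeight hx).mul_prod hs.norm).mono' hmeas.aestronglyMeasurable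
    (ae_of_all _ fun p => ?_)
  rw [norm_gaussianLaplace, norm_prod]

theorem integrable_gaussianFractions (hx : ∀ j, 0 < x j) (hδ : ∀ q, δ q ≠ 0) :
    Integrable (gaussianFractions x c M δ) :=
  (integrable_gaussianLaplace c M hx hδ).integral_prod_left.congr
    (ae_of_all _ fun a => integral_gaussianLaplace_right c M hδ a)

theorem integral_gaussianFractions (hx : ∀ j, 0 < x j) (hδ : ∀ q, δ q ≠ 0) :
    ∫ a, gaussianFractions x c M δ a =
      ((∏ j, Real.sqrt (2 * Real.pi * x j)) * ∫ s : κ → ℝ,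
        (∏ q, halfLineWeight (δ q) (s q) * Real.exp (s q * δ q)) *
          ∏ j, Real.exp (-x j * (c + s ᵥ* M) j ^ 2 / 2) : ℝ) := by
  calc _ = ∫ a, ∫ s, gaussianLaplace x c M δ a s := by
        simp_rw [integral_gaussianLaplace_right c M hδ]
    _ = ∫ s, ∫ a, gaussianLaplace x c M δ a s :=
        integral_integral_swap (integrable_gaussianLaplace c M hx hδ)
    _ = _ := by
        simp_rw [integral_gaussianLaplace_left c M hx]
        rw [integral_complex_ofReal, integral_const_mul]

end Fourier

/-! ### Orderings of a finite set -/

section Orderings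

variable {ι : Type*}

/-- The lists that enumerate the finite set `S` without repetition. -/
def orderings (S : Finset ι) : Finset (List ι) := ⟨S.val.lists, Multiset.lists_nodup_finset S⟩

theorem mem_orderings {S : Finset ι} {l : List ι} :
    l ∈ orderings S ↔ S.val = (l : Multiset ι) := by
  change l ∈ S.val.lists ↔ _
  rw [Multiset.mem_lists_iff]
  rfl

theorem mem_iff_of_mem_orderings {S : Finset ι} {l : List ι} (hl : l ∈ orderings S) {a : ι} :
    a ∈ l ↔ a ∈ S := by
  rw [← Finset.mem_val, mem_orderings.1 hl, Multiset.mem_coe]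

theorem nodup_of_mem_orderings {S : Finset ι} {l : List ι} (hl : l ∈ orderings S) : l.Nodup := by
  rw [← Multiset.coe_nodup, ← mem_orderings.1 hl]
  exact S.nodup

theorem sum_map_of_mem_orderings {M : Type*} [AddCommMonoid M] {S : Finset ι} {l : List ι}
    (hl : l ∈ orderings S) (f : ι → M) : (l.map f).sum = ∑ i ∈ S, f i := by
  rw [mem_orderings] at hl
  rw [Finset.sum, hl, Multiset.map_coe, Multiset.sum_coe]

theorem orderings_empty : orderings (∅ : Finset ι) = {[]} := by
  ext l
  rw [mem_orderings, Finset.mem_singleton, Finset.empty_val, eq_comm, Multiset.coe_eq_zero]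

theorem reverse_mem_orderings {S : Finset ι} {l : List ι} (hl : l ∈ orderings S) :
    l.reverse ∈ orderings S := by
  rw [mem_orderings] at hl ⊢
  rw [hl, Multiset.coe_reverse]

theorem sum_orderings_reverse {M : Type*} [AddCommMonoid M] (S : Finset ι) (f : List ι → M) :
    ∑ l ∈ orderings S, f l.reverse = ∑ l ∈ orderings S, f l :=
  Finset.sum_nbij' List.reverse List.reverse (fun _ => reverse_mem_orderings)
    (fun _ => reverse_mem_orderings) (by simp) (by simp) (by simp)

theorem nil_mem_orderings {S : Finset ι} : [] ∈ orderings S ↔ S = ∅ := by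
  rw [mem_orderings, Multiset.coe_nil, Finset.val_eq_zero]

variable [DecidableEq ι]

theorem cons_mem_orderings {S : Finset ι} {i : ι} {l : List ι} :
    i :: l ∈ orderings S ↔ i ∈ S ∧ l ∈ orderings (S.erase i) := by
  rw [mem_orderings, mem_orderings, Finset.erase_val, ← Multiset.cons_coe]
  constructor
  · intro h
    have hi : i ∈ S := by
      rw [← Finset.mem_val, h]
      exact Multiset.mem_cons_self _ _
    exact ⟨hi, by rw [h, Multiset.erase_cons_head]⟩
  · rintro ⟨hi, h⟩
    rw [← h, Multiset.cons_erase hi]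

theorem sum_orderings_eq_sum_cons {M : Type*} [AddCommMonoid M] (S : Finset ι) (f : List ι → M) :
    ∑ l ∈ orderings S, f l =
      (if S = ∅ then f [] else 0) + ∑ i ∈ S, ∑ l ∈ orderings (S.erase i), f (i :: l) := by
  split_ifs with hS
  · simp [hS, orderings_empty]
  · rw [zero_add, Finset.sum_sigma']
    refine (Finset.sum_bij (fun p _ => p.1 :: p.2)
      (fun p hp => cons_mem_orderings.2 (Finset.mem_sigma.1 hp)) ?_ ?_ fun _ _ => rfl).symm
    · rintro ⟨i, l⟩ _ ⟨j, l'⟩ _ hcons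
      obtain ⟨rfl, rfl⟩ := List.cons_eq_cons.1 hcons
      rfl
    · rintro (_ | ⟨i, l⟩) hl
      · exact absurd (nil_mem_orderings.1 hl) hS
      · exact ⟨⟨i, l⟩, Finset.mem_sigma.2 (cons_mem_orderings.1 hl), rfl⟩

theorem sum_powerset_sum_mem {M : Type*} [AddCommMonoid M] (S : Finset ι)
    (f : ι → Finset ι → M) :
    ∑ A ∈ S.powerset, ∑ a ∈ A, f a (A.erase a) =
      ∑ a ∈ S, ∑ A ∈ (S.erase a).powerset, f a A := by
  rw [Finset.sum_sigma', Finset.sum_sigma']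
  refine Finset.sum_bij' (fun p _ => ⟨p.2, p.1.erase p.2⟩) (fun p _ => ⟨insert p.1 p.2, p.1⟩)
    ?_ ?_ ?_ ?_ fun _ _ => rfl <;> rintro ⟨_, _⟩ h <;>
    simp only [Finset.mem_sigma, Finset.mem_powerset] at h ⊢
  · exact ⟨h.1 h.2, Finset.erase_subset_erase _ h.1⟩
  · exact ⟨Finset.insert_subset h.1 (h.2.trans (Finset.erase_subset _ _)),
      Finset.mem_insert_self _ _⟩
  · rw [Finset.insert_erase h.2]
  · rw [Finset.erase_insert fun ha => (Finset.mem_erase.1 (h.2 ha)).1 rfl]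

theorem sum_powerset_sum_notMem {M : Type*} [AddCommMonoid M] (S : Finset ι)
    (f : ι → Finset ι → M) :
    ∑ A ∈ S.powerset, ∑ a ∈ S \ A, f a A = ∑ a ∈ S, ∑ A ∈ (S.erase a).powerset, f a A := by
  refine Finset.sum_comm' fun A a => ?_
  simp only [Finset.mem_powerset, Finset.mem_sdiff, Finset.subset_erase]
  tauto

theorem sdiff_eq_erase_sdiff_erase {S A : Finset ι} {a : ι} (ha : a ∈ A) :
    S \ A = S.erase a \ A.erase a := by
  grind

theorem sum_orderings_eq_sum_append {M : Type*} [AddCommMonoid M] (S : Finset ι) :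
    ∀ i ∈ S, ∀ f : List ι → M, ∑ l ∈ orderings S, f l =
      ∑ A ∈ (S.erase i).powerset, ∑ l ∈ orderings A, ∑ l' ∈ orderings (S.erase i \ A),
        f (l ++ i :: l') := by
  induction S using Finset.strongInduction with
  | H S ih =>
    intro i hi f
    rw [sum_orderings_eq_sum_cons, if_neg (Finset.ne_empty_of_mem hi), zero_add,
      ← Finset.add_sum_erase _ _ hi]
    simp_rw [fun A : Finset ι => sum_orderings_eq_sum_cons A fun l =>
      ∑ l' ∈ orderings (S.erase i \ A), f (l ++ i :: l')]
    rw [Finset.sum_add_distrib]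
    congr 1
    · rw [Finset.sum_ite_eq']
      simp
    · refine Eq.trans ?_ ((sum_powerset_sum_mem (S.erase i) fun a A => ∑ l ∈ orderings A,
        ∑ l' ∈ orderings ((S.erase i).erase a \ A), f (a :: l ++ i :: l')).symm.trans ?_)
      · refine Finset.sum_congr rfl fun a ha => ?_
        rw [ih _ (Finset.erase_ssubset (Finset.mem_of_mem_erase ha)) i
          (Finset.mem_erase.2 ⟨(Finset.ne_of_mem_erase ha).symm, hi⟩), Finset.erase_right_comm]
        rfl
      · refine Finset.sum_congr rfl fun A _ => Finset.sum_congr rfl fun a ha => ?_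
        rw [sdiff_eq_erase_sdiff_erase ha]

theorem sum_orderings_univ {M : Type*} [AddCommMonoid M] {n : ℕ} (f : List (Fin n) → M) :
    ∑ l ∈ orderings (Finset.univ : Finset (Fin n)), f l =
      ∑ σ : Equiv.Perm (Fin n), f (List.ofFn σ) := by
  refine (Finset.sum_bij (fun (σ : Equiv.Perm (Fin n)) _ => List.ofFn σ) ?_ ?_ ?_
    fun _ _ => rfl).symm
  · intro σ _
    rw [mem_orderings,
      Finset.univ.nodup.ext (Multiset.coe_nodup.2 (List.nodup_ofFn.2 σ.injective))]
    simp only [Finset.mem_val, Finset.mem_univ, Multiset.mem_coe, List.mem_ofFn, true_iff]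
    exact σ.surjective
  · intro σ _ τ _ h
    exact DFunLike.coe_injective (List.ofFn_injective h)
  · intro l hl
    have hlength : l.length = n := by
      rw [← Multiset.coe_card, ← mem_orderings.1 hl, Finset.card_val, Finset.card_fin]
    have hmem (i : Fin n) : i ∈ l := (mem_iff_of_mem_orderings hl).2 (Finset.mem_univ i)
    refine ⟨(finCongr hlength.symm).trans
      ((nodup_of_mem_orderings hl).getEquivOfForallMemList l hmem),
      Finset.mem_univ _, List.ext_get (by simp [hlength]) fun k _ _ => ?_⟩
    simp

theorem sum_orderings_univ_erase {M : Type*} [AddCommMonoid M] {n : ℕ} (i : Fin (n + 1))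
    (f : List (Fin (n + 1)) → M) :
    ∑ l ∈ orderings (Finset.univ.erase i), f (i :: l) =
      ∑ σ : Equiv.Perm (Fin (n + 1)) with σ 0 = i, f (List.ofFn σ) := by
  have hhead := sum_orderings_eq_sum_cons Finset.univ fun l => if l.head? = some i then f l else 0
  rw [if_neg Finset.univ_nonempty.ne_empty, zero_add, sum_orderings_univ,
    Finset.sum_eq_single i (fun j _ hj => by simp [hj]) (by simp)] at hhead
  simpa [List.ofFn_succ, Finset.sum_filter] using hhead.symm

end Orderings

/-! ### Chains of simple fractions and the shuffle identity -/

section Chain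

variable {ι : Type*} (z : ι → ℂ) (ω : ι → ι → ℂ) (α : ι → ℂ) (i : ι)

/-- The product of `1 / (z_a - z_b)` over consecutive elements of a list. -/
def chainProd (z : ι → ℂ) : List ι → ℂ
  | [] => 1
  | [_] => 1
  | a :: b :: l => (z a - z b)⁻¹ * chainProd z (b :: l)

/-- The sum of `ω a b` over all pairs with `a` before `b` in a list. -/
def pairSum (ω : ι → ι → ℂ) : List ι → ℂ
  | [] => 0
  | a :: l => (l.map (ω a)).sum + pairSum ω l

/-- The sum of `ω a b` over `a` in the first list and `b` in the second. -/
def crossSum (ω : ι → ι → ℂ) (l l' : List ι) : ℂ := (l.map fun a => (l'.map (ω a)).sum).sum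

/-- The sum of `e^{∑_{a<b} ω(a,b)} ∏ 1/(z_a - z_{a+1})` over all orderings of `S`. -/
def symSum (ω : ι → ι → ℂ) (z : ι → ℂ) (S : Finset ι) : ℂ :=
  ∑ l ∈ orderings S, Complex.exp (pairSum ω l) * chainProd z l

/-- The product over the elements `j` of a list of `2 sinh (α j + ∑ ω k j)`, where `k` runs over
the elements that precede `j`. -/
def sinhProd (ω : ι → ι → ℂ) : (ι → ℂ) → List ι → ℂ
  | _, [] => 1
  | α, j :: l => (Complex.exp (α j) - Complex.exp (-α j)) * sinhProd ω (α + ω j) l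

/-- For `α = ω i` this is `pairSum ω` of the word `l.reverse ++ i :: l'`; a general `α` records
the pairing with a set of letters that have been removed from the middle of the word. -/
def wordExponent (l l' : List ι) : ℂ :=
  -(l.map α).sum + (l'.map α).sum + crossSum ω l l' - pairSum ω l + pairSum ω l'

/-- The contribution of the word `l.reverse ++ i :: l'` to the symmetrized sum, with the general
linear part `α` of `wordExponent`. -/
def wordTerm (l l' : List ι) : ℂ :=
  (-1) ^ l.length * Complex.exp (wordExponent ω α l l') *
    (chainProd z (i :: l) * chainProd z (i :: l'))

variable {ω}

theorem crossSum_cons_left (a : ι) (l l' : List ι) :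
    crossSum ω (a :: l) l' = (l'.map (ω a)).sum + crossSum ω l l' := by
  simp [crossSum]

theorem crossSum_cons_right (hω : ∀ a b, ω b a = -ω a b) (b : ι) (l l' : List ι) :
    crossSum ω l (b :: l') = -(l.map (ω b)).sum + crossSum ω l l' := by
  induction l with
  | nil => simp [crossSum]
  | cons a l ih =>
    rw [crossSum_cons_left, crossSum_cons_left, ih, List.map_cons, List.map_cons, List.sum_cons,
      List.sum_cons, hω b a]
    ring

theorem wordExponent_cons_left (a : ι) (l l' : List ι) :
    wordExponent ω α (a :: l) l' = -α a + wordExponent ω (α + ω a) l l' := by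
  simp only [wordExponent, crossSum_cons_left, pairSum, List.map_cons, List.sum_cons,
    Pi.add_def, List.sum_map_add]
  ring

theorem wordExponent_cons_right (hω : ∀ a b, ω b a = -ω a b) (b : ι) (l l' : List ι) :
    wordExponent ω α l (b :: l') = α b + wordExponent ω (α + ω b) l l' := by
  simp only [wordExponent, crossSum_cons_right hω, pairSum, List.map_cons, List.sum_cons,
    Pi.add_def, List.sum_map_add]
  ring

theorem chainProd_reverse_append (l l' : List ι) :
    chainProd z (l.reverse ++ i :: l') =
      (-1) ^ l.length * (chainProd z (i :: l) * chainProd z (i :: l')) := by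
  induction l generalizing i l' with
  | nil => simp [chainProd]
  | cons a l ih =>
    rw [List.reverse_cons, List.append_assoc, List.singleton_append, ih, List.length_cons]
    simp only [chainProd]
    rw [← neg_sub (z i) (z a), inv_neg]
    ring

theorem pairSum_reverse_append (hω : ∀ a b, ω b a = -ω a b) (l l' : List ι) :
    pairSum ω (l.reverse ++ i :: l') = wordExponent ω (ω i) l l' := by
  induction l generalizing i l' with
  | nil => simp [pairSum, wordExponent, crossSum]
  | cons a l ih =>
    rw [List.reverse_cons, List.append_assoc, List.singleton_append, ih,
      wordExponent_cons_right _ hω, wordExponent_cons_left, hω i a, add_comm (ω i)]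

theorem exp_pairSum_mul_chainProd (hω : ∀ a b, ω b a = -ω a b) (l l' : List ι) :
    Complex.exp (pairSum ω (l.reverse ++ i :: l')) * chainProd z (l.reverse ++ i :: l') =
      wordTerm z ω (ω i) i l l' := by
  rw [pairSum_reverse_append _ hω, chainProd_reverse_append, wordTerm]
  ring

variable (ω)

/-- The part of `wordTerm` in which the letter next to `i` is split off on the right. -/
def wordTermRight (l : List ι) : List ι → ℂ
  | [] => 0
  | b :: l' => (z i - z b)⁻¹ * (Complex.exp (α b) * wordTerm z ω (α + ω b) b l l')

/-- The part of `wordTerm` in which the letter next to `i` is split off on the left. -/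
def wordTermLeft (l' : List ι) : List ι → ℂ
  | [] => 0
  | a :: l => -((z i - z a)⁻¹ * (Complex.exp (-α a) * wordTerm z ω (α + ω a) a l l'))

variable {ω} {i}

theorem inv_sub_mul_inv_sub {u v w : ℂ} (hv : u ≠ v) (hw : u ≠ w) (hvw : v ≠ w) :
    (u - v)⁻¹ * (u - w)⁻¹ = (u - w)⁻¹ * (w - v)⁻¹ + (u - v)⁻¹ * (v - w)⁻¹ := by
  have := sub_ne_zero.2 hv
  have := sub_ne_zero.2 hw
  have := sub_ne_zero.2 hvw
  rw [← neg_sub v w, inv_neg]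
  field_simp
  ring

/-- The partial fraction expansion in `z i`. -/
theorem wordTerm_eq_add (hω : ∀ a b, ω b a = -ω a b) {z : ι → ℂ} (hz : Function.Injective z)
    {l l' : List ι} (hne : l ≠ [] ∨ l' ≠ []) (hl : i ∉ l) (hl' : i ∉ l') (hll' : l.Disjoint l') :
    wordTerm z ω α i l l' = wordTermRight z ω α i l l' + wordTermLeft z ω α i l' l := by
  match l, l' with
  | [], [] => simp at hne
  | [], b :: l' =>
    simp only [wordTermRight, wordTermLeft, wordTerm, chainProd, wordExponent_cons_right _ hω,
      Complex.exp_add]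
    ring
  | a :: l, [] =>
    simp only [wordTermRight, wordTermLeft, wordTerm, chainProd, wordExponent_cons_left,
      Complex.exp_add, List.length_cons]
    ring
  | a :: l, b :: l' =>
    have hab : a ≠ b := fun h => hll' (List.mem_cons_self ..) (h ▸ List.mem_cons_self ..)
    have hfrac := inv_sub_mul_inv_sub (hz.ne (List.ne_of_not_mem_cons hl))
      (hz.ne (List.ne_of_not_mem_cons hl')) (hz.ne hab)
    have hright : Complex.exp (α b + wordExponent ω (α + ω b) (a :: l) l') =
        Complex.exp (wordExponent ω α (a :: l) (b :: l')) := by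
      rw [wordExponent_cons_right _ hω]
    have hleft : Complex.exp (-α a + wordExponent ω (α + ω a) l (b :: l')) =
        Complex.exp (wordExponent ω α (a :: l) (b :: l')) := by
      rw [wordExponent_cons_left]
    rw [Complex.exp_add] at hright hleft
    simp only [wordTermRight, wordTermLeft, wordTerm, chainProd, List.length_cons, pow_succ]
    linear_combination (-1) ^ l.length * (-1) * chainProd z (a :: l) * chainProd z (b :: l') *
      (Complex.exp (wordExponent ω α (a :: l) (b :: l')) * hfrac
        - (z i - z b)⁻¹ * (z b - z a)⁻¹ * hright - (z i - z a)⁻¹ * (z a - z b)⁻¹ * hleft)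

variable [DecidableEq ι]

variable (ω i) in
/-- The sum of `wordTerm` over all words `l.reverse ++ i :: l'` in which each letter of `S` occurs
once. -/
def wordSum (S : Finset ι) : ℂ :=
  ∑ A ∈ S.powerset, ∑ l ∈ orderings A, ∑ l' ∈ orderings (S \ A), wordTerm z ω α i l l'

theorem sum_wordTermRight (S : Finset ι) :
    ∑ A ∈ S.powerset, ∑ l ∈ orderings A, ∑ l' ∈ orderings (S \ A), wordTermRight z ω α i l l' =
      ∑ j ∈ S, (z i - z j)⁻¹ * (Complex.exp (α j) * wordSum z ω (α + ω j) j (S.erase j)) := by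
  have hinner (A : Finset ι) :
      ∑ l ∈ orderings A, ∑ l' ∈ orderings (S \ A), wordTermRight z ω α i l l' =
        ∑ j ∈ S \ A, ∑ l ∈ orderings A, ∑ l' ∈ orderings (S.erase j \ A),
          (z i - z j)⁻¹ * (Complex.exp (α j) * wordTerm z ω (α + ω j) j l l') := by
    rw [Finset.sum_comm (s := S \ A)]
    refine Finset.sum_congr rfl fun l _ => ?_
    rw [sum_orderings_eq_sum_cons]
    simp only [wordTermRight, ite_self, zero_add, Finset.erase_sdiff_comm]
  simp_rw [hinner]
  rw [sum_powerset_sum_notMem S fun j A => ∑ l ∈ orderings A, ∑ l' ∈ orderings (S.erase j \ A),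
    (z i - z j)⁻¹ * (Complex.exp (α j) * wordTerm z ω (α + ω j) j l l')]
  simp only [wordSum, Finset.mul_sum]

theorem sum_wordTermLeft (S : Finset ι) :
    ∑ A ∈ S.powerset, ∑ l ∈ orderings A, ∑ l' ∈ orderings (S \ A), wordTermLeft z ω α i l' l =
      ∑ j ∈ S, -((z i - z j)⁻¹ * (Complex.exp (-α j) * wordSum z ω (α + ω j) j (S.erase j))) := by
  have hinner (A : Finset ι) :
      ∑ l ∈ orderings A, ∑ l' ∈ orderings (S \ A), wordTermLeft z ω α i l' l =
        ∑ j ∈ A, ∑ l ∈ orderings (A.erase j), ∑ l' ∈ orderings (S.erase j \ A.erase j),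
          -((z i - z j)⁻¹ * (Complex.exp (-α j) * wordTerm z ω (α + ω j) j l l')) := by
    rw [sum_orderings_eq_sum_cons]
    simp only [wordTermLeft, Finset.sum_const_zero, ite_self, zero_add]
    refine Finset.sum_congr rfl fun j hj => ?_
    rw [sdiff_eq_erase_sdiff_erase hj]
  simp_rw [hinner]
  rw [sum_powerset_sum_mem S fun j A => ∑ l ∈ orderings A, ∑ l' ∈ orderings (S.erase j \ A),
    -((z i - z j)⁻¹ * (Complex.exp (-α j) * wordTerm z ω (α + ω j) j l l'))]
  simp only [wordSum, Finset.mul_sum, Finset.sum_neg_distrib]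

theorem wordSum_eq_sum (hω : ∀ a b, ω b a = -ω a b) {z : ι → ℂ} (hz : Function.Injective z)
    {S : Finset ι} (hS : S.Nonempty) (hi : i ∉ S) :
    wordSum z ω α i S = ∑ j ∈ S, (z i - z j)⁻¹ *
      ((Complex.exp (α j) - Complex.exp (-α j)) * wordSum z ω (α + ω j) j (S.erase j)) := by
  have hsplit : ∀ A ∈ S.powerset, ∀ l ∈ orderings A, ∀ l' ∈ orderings (S \ A),
      wordTerm z ω α i l l' = wordTermRight z ω α i l l' + wordTermLeft z ω α i l' l := by
    intro A hA l hl l' hl'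
    refine wordTerm_eq_add α hω hz ?_ ?_ ?_ ?_
    · by_contra! hnil
      rw [hnil.1, nil_mem_orderings] at hl
      rw [hnil.2, nil_mem_orderings, hl, Finset.sdiff_empty] at hl'
      exact hS.ne_empty hl'
    · rw [mem_iff_of_mem_orderings hl]
      exact fun h => hi (Finset.mem_powerset.1 hA h)
    · rw [mem_iff_of_mem_orderings hl', Finset.mem_sdiff]
      exact fun h => hi h.1
    · intro a ha ha'
      rw [mem_iff_of_mem_orderings hl', Finset.mem_sdiff, ← mem_iff_of_mem_orderings hl] at ha'
      exact ha'.2 ha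
  rw [wordSum, Finset.sum_congr rfl fun A hA => Finset.sum_congr rfl fun l hl =>
    Finset.sum_congr rfl fun l' hl' => hsplit A hA l hl l' hl']
  simp only [Finset.sum_add_distrib]
  rw [sum_wordTermRight, sum_wordTermLeft, ← Finset.sum_add_distrib]
  refine Finset.sum_congr rfl fun j _ => ?_
  ring

theorem sum_chainProd_mul_sinhProd (hω : ∀ a b, ω b a = -ω a b) {z : ι → ℂ}
    (hz : Function.Injective z) (S : Finset ι) (hi : i ∉ S) :
    ∑ l ∈ orderings S, chainProd z (i :: l) * sinhProd ω α l = wordSum z ω α i S := by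
  induction S using Finset.strongInduction generalizing i α with
  | H S ih =>
    rcases S.eq_empty_or_nonempty with rfl | hS
    · simp [orderings_empty, chainProd, sinhProd, wordSum, wordTerm, wordExponent, crossSum,
        pairSum]
    rw [wordSum_eq_sum α hω hz hS hi, sum_orderings_eq_sum_cons, if_neg hS.ne_empty, zero_add]
    refine Finset.sum_congr rfl fun j hj => ?_
    rw [← ih _ (Finset.erase_ssubset hj) _ (Finset.notMem_erase _ _), Finset.mul_sum,
      Finset.mul_sum]
    refine Finset.sum_congr rfl fun l _ => ?_
    simp only [chainProd, sinhProd]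
    ring

/-- Both sides are sums over all words: on the left unfolded from the position of `i`, on the right
built outwards from `i`. -/
theorem symSum_eq_sum_cons (hω : ∀ a b, ω b a = -ω a b) {z : ι → ℂ} (hz : Function.Injective z)
    {S : Finset ι} (hi : i ∈ S) :
    symSum ω z S = ∑ l ∈ orderings (S.erase i), chainProd z (i :: l) * sinhProd ω (ω i) l := by
  rw [symSum, sum_orderings_eq_sum_append S i hi,
    sum_chainProd_mul_sinhProd _ hω hz _ (Finset.notMem_erase _ _)]
  refine Finset.sum_congr rfl fun A _ => ?_
  rw [← sum_orderings_reverse]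
  simp only [exp_pairSum_mul_chainProd _ _ hω]

end Chain

/-! ### The symmetric form of Buryak's function -/

section SymmetricForm

variable {ι : Type*}

/-- The antisymmetric form `x_a x_b (z_a - z_b) / 2`; for `z_a = f_a / x_a` it is half of the
argument `f_a x_b - f_b x_a` of `ζ` in Buryak's formula. -/
def weightForm (x z : ι → ℂ) (a b : ι) : ℂ := x a * x b * (z a - z b) / 2

theorem weightForm_antisymm (x z : ι → ℂ) (a b : ι) : weightForm x z b a = -weightForm x z a b := by
  unfold weightForm; ring

theorem two_mul_sum_weightForm {x : ι → ℂ} (hx : ∀ i, x i ≠ 0) (a : ι → ℂ) {κ : Type*}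
    (S : Finset κ) (v : κ → ι) (j : ι) :
    2 * ∑ k ∈ S, weightForm x (a / x) (v k) j =
      (∑ k ∈ S, a (v k)) * x j - a j * ∑ k ∈ S, x (v k) := by
  rw [Finset.sum_mul, Finset.mul_sum, Finset.mul_sum, ← Finset.sum_sub_distrib]
  refine Finset.sum_congr rfl fun k _ => ?_
  have := hx (v k)
  have := hx j
  simp only [weightForm, Pi.div_apply]
  field_simp

theorem chainProd_ofFn (z : ι → ℂ) {m : ℕ} (v : Fin (m + 1) → ι) :
    chainProd z (List.ofFn v) = ∏ k : Fin m, (z (v k.castSucc) - z (v k.succ))⁻¹ := by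
  induction m with
  | zero => simp [chainProd]
  | succ m ih =>
    have htail := ih fun k => v k.succ
    rw [List.ofFn_succ] at htail
    rw [List.ofFn_succ, List.ofFn_succ, chainProd, htail, Fin.prod_univ_succ]
    rfl

theorem sum_Iic_castSucc_eq_add {M : Type*} [AddCommMonoid M] {m : ℕ} (f : Fin (m + 1) → M)
    (j : Fin m) :
    ∑ k ∈ Finset.Iic j.castSucc, f k = f 0 + ∑ k ∈ Finset.Iio j, f k.succ := by
  simp only [← Finset.filter_ge_eq_Iic, ← Finset.filter_gt_eq_Iio, Finset.sum_filter,
    Fin.sum_univ_succ, Fin.zero_le, if_true, Fin.succ_le_castSucc_iff]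

theorem Iio_succ_eq_Iic_castSucc {m : ℕ} (j : Fin m) :
    Finset.Iio j.succ = Finset.Iic j.castSucc := by
  ext k
  simp [Fin.le_castSucc_iff]

theorem sinhProd_ofFn (ω : ι → ι → ℂ) {m : ℕ} (v : Fin m → ι) (α : ι → ℂ) :
    sinhProd ω α (List.ofFn v) =
      ∏ j, buryakZeta (2 * (α (v j) + ∑ k ∈ Finset.Iio j, ω (v k) (v j))) := by
  induction m generalizing α with
  | zero => simp [sinhProd]
  | succ m ih =>
    rw [List.ofFn_succ, sinhProd, ih, Fin.prod_univ_succ]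
    congr 1
    · have hempty : Finset.Iio (0 : Fin (m + 1)) = ∅ := Finset.Iio_eq_empty.2 isMin_bot
      simp [buryakZeta, neg_div, hempty]
    · refine Finset.prod_congr rfl fun j _ => ?_
      rw [Iio_succ_eq_Iic_castSucc, sum_Iic_castSucc_eq_add, Pi.add_apply, add_assoc]

theorem sinhProd_ofFn_succ (ω : ι → ι → ℂ) {m : ℕ} (v : Fin (m + 1) → ι) :
    sinhProd ω (ω (v 0)) (List.ofFn fun j => v (Fin.succ j)) =
      ∏ j : Fin m, buryakZeta (2 * ∑ k ∈ Finset.Iic j.castSucc, ω (v k) (v j.succ)) := by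
  simp only [sinhProd_ofFn, sum_Iic_castSucc_eq_add]

theorem prod_castSucc_eq {m : ℕ} (f : Fin (m + 2) → ℂ) :
    ∏ j : Fin (m + 1), f j.castSucc = f 0 * ∏ j ∈ Finset.Ioo 0 (Fin.last (m + 1)), f j := by
  have hmap : (Finset.Ioi (0 : Fin (m + 1))).map Fin.castSuccEmb =
      Finset.Ioo 0 (Fin.last (m + 1)) := Fin.map_castSuccEmb_Ioi 0
  rw [Fin.prod_univ_succ, ← hmap, Finset.prod_map,
    Fin.prod_Ioi_zero (f := fun j : Fin (m + 1) => f (Fin.castSuccEmb j))]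
  rfl

theorem prod_Ioo_div_prod_mul_sub_mul {m : ℕ} (a : Fin (m + 2) → ℂ) {x : Fin (m + 2) → ℂ}
    (hx : ∀ i, x i ≠ 0) :
    (∏ j ∈ Finset.Ioo 0 (Fin.last (m + 1)), x j) /
      ∏ j : Fin (m + 1), (a j.castSucc * x j.succ - a j.succ * x j.castSucc) =
      (∏ j, x j)⁻¹ * ∏ j : Fin (m + 1), (a j.castSucc / x j.castSucc - a j.succ / x j.succ)⁻¹ := by
  have hfactor (j : Fin (m + 1)) : a j.castSucc * x j.succ - a j.succ * x j.castSucc =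
      x j.castSucc * x j.succ * (a j.castSucc / x j.castSucc - a j.succ / x j.succ) := by
    have := hx j.castSucc
    have := hx j.succ
    field_simp
  have hIoo : ∏ j ∈ Finset.Ioo 0 (Fin.last (m + 1)), x j ≠ 0 :=
    Finset.prod_ne_zero_iff.2 fun j _ => hx j
  simp_rw [hfactor, Finset.prod_mul_distrib, prod_castSucc_eq, Fin.prod_univ_succ x,
    Finset.prod_inv_distrib]
  rw [div_eq_mul_inv, mul_inv, mul_inv, mul_inv, mul_inv]
  field_simp

theorem buryakP_eq_symSum {n : ℕ} (hn : 1 ≤ n) {a x : Fin n → ℂ} (hx : ∀ i, x i ≠ 0)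
    (hz : Function.Injective (a / x)) :
    buryakP n a x = (∏ j, x j)⁻¹ * symSum (weightForm x (a / x)) (a / x) Finset.univ := by
  match n, hn with
  | 1, _ =>
    rw [symSum, sum_orderings_univ]
    simp [buryakP, chainProd, pairSum]
  | m + 2, _ =>
    rw [symSum_eq_sum_cons (weightForm_antisymm x _) hz (Finset.mem_univ (0 : Fin (m + 2))),
      ← Finset.sum_congr rfl fun l _ => congrArg (chainProd _ (0 :: l) * ·)
        (congrArg (sinhProd _ _) (List.tail_cons (a := 0) (as := l))),
      sum_orderings_univ_erase 0 fun l => chainProd _ l * sinhProd _ _ l.tail,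
      buryakP, Finset.mul_sum]
    refine Finset.sum_congr rfl fun τ hτ => ?_
    have hzero : τ 0 = 0 := (Finset.mem_filter.1 hτ).2
    have hsinh := sinhProd_ofFn_succ (weightForm x (a / x)) τ
    rw [hzero] at hsinh
    rw [mul_div_right_comm, prod_Ioo_div_prod_mul_sub_mul (fun j => a (τ j))
      (x := fun j => x (τ j)) fun j => hx (τ j), Equiv.prod_comp τ x,
      chainProd_ofFn, List.ofFn_succ, List.tail_cons, hsinh, mul_assoc]
    simp only [two_mul_sum_weightForm hx, Pi.div_apply]

end SymmetricForm

/-! ### Boundedness of the symmetric form -/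

section Bound

variable {ι : Type*}

/-- The sum of `F l₁ l₂` over all ways to write a list as `l₁ ++ l₂`. -/
def cutSum : (List ι → List ι → ℂ) → List ι → ℂ
  | F, [] => F [] []
  | F, a :: l => F [] (a :: l) + cutSum (fun l₁ l₂ => F (a :: l₁) l₂) l

theorem cutSum_add (F G : List ι → List ι → ℂ) (l : List ι) :
    cutSum (fun l₁ l₂ => F l₁ l₂ + G l₁ l₂) l = cutSum F l + cutSum G l := by
  induction l generalizing F G with
  | nil => rfl
  | cons a l ih => simp only [cutSum, ih]; ring

theorem cutSum_mul_left (c : ℂ) (F : List ι → List ι → ℂ) (l : List ι) :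
    cutSum (fun l₁ l₂ => c * F l₁ l₂) l = c * cutSum F l := by
  induction l generalizing F with
  | nil => rfl
  | cons a l ih => simp only [cutSum, ih]; ring

theorem cutSum_mul_append (F : List ι → List ι → ℂ) (E : List ι → ℂ) (l : List ι) :
    cutSum (fun l₁ l₂ => F l₁ l₂ * E (l₁ ++ l₂)) l = cutSum F l * E l := by
  induction l generalizing F E with
  | nil => rfl
  | cons a l ih =>
    simp only [cutSum, List.cons_append, List.nil_append]
    rw [ih (fun l₁ l₂ => F (a :: l₁) l₂) (fun l => E (a :: l))]
    ring

theorem sum_map_mul_sub (x z : ι → ℂ) (b d : ι) (l : List ι) :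
    (l.map fun k => x k * (z b - z k)).sum =
      (l.map x).sum * (z b - z d) + (l.map fun k => x k * (z d - z k)).sum := by
  induction l with
  | nil => simp
  | cons a l ih => simp only [List.map_cons, List.sum_cons, ih]; ring

theorem cutSum_sum_right_mul_chainProd (x : ι → ℂ) {z : ι → ℂ} (hz : Function.Injective z) (b : ι)
    {l : List ι} (hl : (b :: l).Nodup) :
    cutSum (fun l₁ l₂ => (l₂.map x).sum * chainProd z (b :: l₁) * chainProd z l₂) l =
      chainProd z (b :: l) * (l.map fun k => x k * (z b - z k)).sum := by
  induction l generalizing b with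
  | nil => simp [cutSum]
  | cons d l ih =>
    have hbd : z b - z d ≠ 0 := sub_ne_zero.2 (hz.ne (List.ne_of_not_mem_cons hl.notMem))
    have hcons : (fun l₁ l₂ => (l₂.map x).sum * chainProd z (b :: d :: l₁) * chainProd z l₂) =
        fun l₁ l₂ => (z b - z d)⁻¹ * ((l₂.map x).sum * chainProd z (d :: l₁) * chainProd z l₂) := by
      funext l₁ l₂
      simp only [chainProd]
      ring
    rw [cutSum, hcons, cutSum_mul_left, ih d hl.of_cons]
    simp only [chainProd, List.map_cons, List.sum_cons]
    rw [sum_map_mul_sub x z b d l]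
    field_simp
    ring

theorem two_mul_sum_map_weightForm (x z : ι → ℂ) (b : ι) (l : List ι) :
    2 * (l.map (weightForm x z b)).sum = x b * (l.map fun k => x k * (z b - z k)).sum := by
  rw [← List.sum_map_mul_left, ← List.sum_map_mul_left]
  congr 2
  funext k
  rw [weightForm]
  ring

theorem cutSum_chainProd_cons (x : ι → ℂ) {z : ι → ℂ} (hz : Function.Injective z) (b : ι)
    {l : List ι} (hl : (b :: l).Nodup) :
    cutSum (fun l₁ l₂ => ((b :: l₁).map x).sum * (l₂.map x).sum * chainProd z (b :: l₁) *
      chainProd z l₂) l = 2 * pairSum (weightForm x z) (b :: l) * chainProd z (b :: l) := by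
  induction l generalizing b with
  | nil => simp [cutSum, pairSum]
  | cons d l ih =>
    have hbd : z b - z d ≠ 0 := sub_ne_zero.2 (hz.ne (List.ne_of_not_mem_cons hl.notMem))
    have hcons : (fun l₁ l₂ => ((b :: d :: l₁).map x).sum * (l₂.map x).sum *
        chainProd z (b :: d :: l₁) * chainProd z l₂) =
        fun l₁ l₂ => (z b - z d)⁻¹ * (x b *
          ((l₂.map x).sum * chainProd z (d :: l₁) * chainProd z l₂)) +
          (z b - z d)⁻¹ * (((d :: l₁).map x).sum * (l₂.map x).sum * chainProd z (d :: l₁) *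
            chainProd z l₂) := by
      funext l₁ l₂
      simp only [chainProd, List.map_cons, List.sum_cons]
      ring
    have hpair : 2 * pairSum (weightForm x z) (b :: d :: l) =
        x b * ((d :: l).map fun k => x k * (z b - z k)).sum +
          2 * pairSum (weightForm x z) (d :: l) := by
      rw [pairSum, mul_add, two_mul_sum_map_weightForm]
    rw [cutSum, hcons, cutSum_add, cutSum_mul_left, cutSum_mul_left, cutSum_mul_left,
      ih d hl.of_cons, cutSum_sum_right_mul_chainProd x hz d hl.of_cons, hpair,
      sum_map_mul_sub x z b d]
    simp only [chainProd, List.map_cons, List.sum_cons, List.map_nil, List.sum_nil]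
    field_simp
    ring

theorem cutSum_chainProd (x : ι → ℂ) {z : ι → ℂ} (hz : Function.Injective z) {l : List ι}
    (hl : l.Nodup) :
    cutSum (fun l₁ l₂ => (l₁.map x).sum * (l₂.map x).sum * chainProd z l₁ * chainProd z l₂) l =
      2 * pairSum (weightForm x z) l * chainProd z l := by
  match l with
  | [] => simp [cutSum, pairSum]
  | b :: l =>
    rw [cutSum, cutSum_chainProd_cons x hz b hl]
    simp

theorem pairSum_append (ω : ι → ι → ℂ) (l l' : List ι) :
    pairSum ω (l ++ l') = pairSum ω l + crossSum ω l l' + pairSum ω l' := by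
  induction l with
  | nil => simp [pairSum, crossSum]
  | cons a l ih =>
    simp only [List.cons_append, pairSum, ih, crossSum_cons_left, List.map_append, List.sum_append]
    ring

theorem pairSum_const_mul (c : ℂ) (ω : ι → ι → ℂ) (l : List ι) :
    pairSum (fun a b => c * ω a b) l = c * pairSum ω l := by
  induction l with
  | nil => simp [pairSum]
  | cons a l ih => simp only [pairSum, ih, mul_add, List.sum_map_mul_left]

theorem crossSum_of_mem_orderings (ω : ι → ι → ℂ) {A B : Finset ι} {l l' : List ι}
    (hl : l ∈ orderings A) (hl' : l' ∈ orderings B) :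
    crossSum ω l l' = ∑ i ∈ A, ∑ j ∈ B, ω i j := by
  simp only [crossSum, sum_map_of_mem_orderings hl, sum_map_of_mem_orderings hl']

theorem hasDerivAt_symSum_mul (ω : ι → ι → ℂ) (z : ι → ℂ) (S : Finset ι) (θ : ℝ) :
    HasDerivAt (fun θ : ℝ => symSum (fun a b => θ * ω a b) z S)
      (∑ l ∈ orderings S, Complex.exp (θ * pairSum ω l) * pairSum ω l * chainProd z l) θ := by
  simp only [symSum, pairSum_const_mul]
  refine HasDerivAt.fun_sum fun l _ => HasDerivAt.mul_const ?_ _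
  simpa only [id, Complex.ofReal_one, one_mul] using
    ((hasDerivAt_id θ).ofReal_comp.mul_const (pairSum ω l)).cexp

section DecidableEq

variable [DecidableEq ι]

theorem sum_orderings_cutSum (S : Finset ι) (F : List ι → List ι → ℂ) :
    ∑ l ∈ orderings S, cutSum F l =
      ∑ A ∈ S.powerset, ∑ l₁ ∈ orderings A, ∑ l₂ ∈ orderings (S \ A), F l₁ l₂ := by
  induction S using Finset.strongInduction generalizing F with
  | H S ih =>
    have hcons : ∑ A ∈ S.powerset, ∑ a ∈ A, ∑ l ∈ orderings (A.erase a), ∑ l₂ ∈ orderings (S \ A),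
        F (a :: l) l₂ = ∑ a ∈ S, ∑ l ∈ orderings (S.erase a),
          cutSum (fun l₁ l₂ => F (a :: l₁) l₂) l := by
      rw [← Finset.sum_congr rfl fun a ha => (ih _ (Finset.erase_ssubset ha) _).symm,
        ← sum_powerset_sum_mem S fun a A => ∑ l ∈ orderings A,
          ∑ l₂ ∈ orderings (S.erase a \ A), F (a :: l) l₂]
      exact Finset.sum_congr rfl fun A _ => Finset.sum_congr rfl fun a ha => by
        rw [sdiff_eq_erase_sdiff_erase ha]
    simp_rw [fun A : Finset ι => sum_orderings_eq_sum_cons A fun l₁ =>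
      ∑ l₂ ∈ orderings (S \ A), F l₁ l₂]
    rw [Finset.sum_add_distrib, Finset.sum_ite_eq', if_pos (Finset.empty_mem_powerset S),
      Finset.sdiff_empty, sum_orderings_eq_sum_cons S (F []), hcons, sum_orderings_eq_sum_cons,
      add_assoc, ← Finset.sum_add_distrib]
    simp only [cutSum, Finset.sum_add_distrib]

/-- Differentiating the exponential brings down `pairSum`, which `cutSum_chainProd` turns into a sum
over all ways to cut the ordering into two. -/
theorem hasDerivAt_symSum (x : ι → ℂ) {z : ι → ℂ} (hz : Function.Injective z) (S : Finset ι)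
    (θ : ℝ) :
    HasDerivAt (fun θ : ℝ => symSum (fun a b => θ * weightForm x z a b) z S)
      (∑ A ∈ S.powerset, 1 / 2 * (∑ i ∈ A, x i) * (∑ i ∈ S \ A, x i) *
        Complex.exp (θ * ∑ i ∈ A, ∑ j ∈ S \ A, weightForm x z i j) *
        symSum (fun a b => θ * weightForm x z a b) z A *
        symSum (fun a b => θ * weightForm x z a b) z (S \ A)) θ := by
  convert hasDerivAt_symSum_mul (weightForm x z) z S θ using 1
  set ω := weightForm x z
  have hcut : ∀ l ∈ orderings S, Complex.exp (θ * pairSum ω l) * pairSum ω l * chainProd z l =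
      cutSum (fun l₁ l₂ => 1 / 2 * ((l₁.map x).sum * (l₂.map x).sum * chainProd z l₁ *
        chainProd z l₂) * Complex.exp (θ * pairSum ω (l₁ ++ l₂))) l := by
    intro l hl
    rw [cutSum_mul_append _ (fun l => Complex.exp (θ * pairSum ω l)), cutSum_mul_left,
      cutSum_chainProd x hz (nodup_of_mem_orderings hl)]
    ring
  rw [Finset.sum_congr rfl hcut, sum_orderings_cutSum]
  refine Finset.sum_congr rfl fun A _ => ?_
  rw [symSum, symSum, mul_assoc, Finset.sum_mul_sum, Finset.mul_sum]
  refine Finset.sum_congr rfl fun l₁ hl₁ => ?_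
  rw [Finset.mul_sum]
  refine Finset.sum_congr rfl fun l₂ hl₂ => ?_
  rw [sum_map_of_mem_orderings hl₁, sum_map_of_mem_orderings hl₂, pairSum_append,
    crossSum_of_mem_orderings ω hl₁ hl₂, pairSum_const_mul, pairSum_const_mul, mul_add, mul_add,
    Complex.exp_add, Complex.exp_add]
  ring

end DecidableEq

theorem symSum_zero_of_one_lt_card {z : ι → ℂ} (hz : Function.Injective z) {S : Finset ι}
    (hS : 1 < S.card) : symSum (fun _ _ => 0) z S = 0 := by
  classical
  obtain ⟨i, hi⟩ := Finset.card_pos.1 (zero_lt_one.trans hS)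
  rw [symSum_eq_sum_cons (by simp) hz hi]
  refine Finset.sum_eq_zero fun l hl => ?_
  match l with
  | [] =>
    rw [nil_mem_orderings, ← Finset.card_eq_zero, Finset.card_erase_of_mem hi] at hl
    omega
  | j :: l => simp [sinhProd]

theorem symSum_eq_one_of_card_le_one (ω : ι → ι → ℂ) (z : ι → ℂ) {S : Finset ι}
    (hS : S.card ≤ 1) : symSum ω z S = 1 := by
  classical
  rcases S.eq_empty_or_nonempty with rfl | hne
  · simp [symSum, orderings_empty, pairSum, chainProd]
  · obtain ⟨i, rfl⟩ := Finset.card_eq_one.1 (le_antisymm hS hne.card_pos)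
    rw [symSum, sum_orderings_eq_sum_cons]
    simp [orderings_empty, pairSum, chainProd]

theorem norm_exp_mul_sum_sum_le {ω : ι → ι → ℂ} {R : ℝ} (hR : ∀ a b, |(ω a b).re| ≤ R)
    (A B : Finset ι) {θ : ℝ} (hθ : θ ∈ Set.Icc (0 : ℝ) 1) :
    ‖Complex.exp (θ * ∑ i ∈ A, ∑ j ∈ B, ω i j)‖ ≤ Real.exp (A.card * (B.card * R)) := by
  have hsum : |(∑ i ∈ A, ∑ j ∈ B, ω i j).re| ≤ A.card * (B.card * R) := by
    simp only [Complex.re_sum, ← nsmul_eq_mul]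
    exact (Finset.abs_sum_le_sum_abs _ _).trans (Finset.sum_le_card_nsmul _ _ _ fun i _ =>
      (Finset.abs_sum_le_sum_abs _ _).trans (Finset.sum_le_card_nsmul _ _ _ fun j _ => hR i j))
  rw [Complex.norm_exp, Complex.re_ofReal_mul, Real.exp_le_exp]
  calc θ * (∑ i ∈ A, ∑ j ∈ B, ω i j).re ≤ |θ * (∑ i ∈ A, ∑ j ∈ B, ω i j).re| := le_abs_self _
    _ = θ * |(∑ i ∈ A, ∑ j ∈ B, ω i j).re| := by rw [abs_mul, abs_of_nonneg hθ.1]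
    _ ≤ |(∑ i ∈ A, ∑ j ∈ B, ω i j).re| := mul_le_of_le_one_left (abs_nonneg _) hθ.2
    _ ≤ _ := hsum

/-- The bound is uniform in `z`, although the summands of `symSum` blow up where two of the `z a`
collide: the derivative in `θ` is a sum of products of the symmetrized sums of proper subsets. -/
theorem exists_norm_symSum_le (x : ι → ℂ) (R : ℝ) (S : Finset ι) :
    ∃ C, ∀ z : ι → ℂ, Function.Injective z → (∀ a b, |(weightForm x z a b).re| ≤ R) →
      ∀ θ ∈ Set.Icc (0 : ℝ) 1, ‖symSum (fun a b => θ * weightForm x z a b) z S‖ ≤ C := by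
  classical
  induction S using Finset.strongInduction with
  | H S ih =>
    rcases le_or_gt S.card 1 with hS | hS
    · exact ⟨1, fun z _ _ θ _ => by simp [symSum_eq_one_of_card_le_one _ _ hS]⟩
    choose! C hC using ih
    set D : ℝ := ∑ A ∈ S.powerset, 1 / 2 * ‖∑ i ∈ A, x i‖ * ‖∑ i ∈ S \ A, x i‖ *
      Real.exp (A.card * ((S \ A).card * R)) * |C A| * |C (S \ A)| with hD
    refine ⟨D, fun z hz hR θ hθ => ?_⟩
    have hzero : symSum (fun a b => ((0 : ℝ) : ℂ) * weightForm x z a b) z S = 0 := by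
      simp only [Complex.ofReal_zero, zero_mul]
      exact symSum_zero_of_one_lt_card hz hS
    have hmean := norm_image_sub_le_of_norm_deriv_le_segment'
      (fun t (_ : t ∈ Set.Icc (0 : ℝ) 1) => (hasDerivAt_symSum x hz S t).hasDerivWithinAt)
      (C := D) ?_ θ hθ
    · rw [hzero, sub_zero, sub_zero] at hmean
      exact hmean.trans (mul_le_of_le_one_right (by positivity) hθ.2)
    intro t ht
    have ht' : t ∈ Set.Icc (0 : ℝ) 1 := Set.Ico_subset_Icc_self ht
    refine norm_sum_le_of_le _ fun A hA => ?_
    rw [Finset.mem_powerset] at hA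
    rcases A.eq_empty_or_nonempty with rfl | hne
    · simp
    rcases hA.eq_or_ssubset with rfl | hss
    · simp
    simp only [norm_mul]
    gcongr
    · simp
    · exact norm_exp_mul_sum_sum_le hR _ _ ht'
    · exact (hC A hss z hz hR t ht').trans (le_abs_self _)
    · exact (hC _ (Finset.sdiff_ssubset hA hne) z hz hR t ht').trans (le_abs_self _)

end Bound

/-! ### Linear chains -/

section LinearChain

variable {m : ℕ}

/-- Half of the difference between the sum of the later and of the earlier entries. -/
def chainShift (y : Fin m → ℝ) (k : Fin m) : ℝ :=
  (∑ l, y l) / 2 - Fin.partialSum y k.castSucc - y k / 2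

theorem partialSum_last (y : Fin m → ℝ) : Fin.partialSum y (Fin.last m) = ∑ l, y l := by
  rw [Fin.partialSum, Fin.val_last, List.take_of_length_le (List.length_ofFn).le, List.sum_ofFn]

theorem sum_succ_sub_castSucc (f : Fin (m + 1) → ℝ) :
    ∑ k : Fin m, (f k.succ - f k.castSucc) = f (Fin.last m) - f 0 := by
  have hsucc := Fin.sum_univ_succ f
  have hcastSucc := Fin.sum_univ_castSucc f
  rw [Finset.sum_sub_distrib]
  linarith

theorem chainShift_zero (y : Fin (m + 1) → ℝ) : chainShift y 0 = (∑ l : Fin m, y l.succ) / 2 := by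
  rw [chainShift, Fin.castSucc_zero, Fin.partialSum_zero, Fin.sum_univ_succ]
  ring

theorem chainShift_succ (y : Fin (m + 1) → ℝ) (k : Fin m) :
    chainShift y k.succ = chainShift (fun l => y (Fin.succ l)) k - y 0 / 2 := by
  rw [chainShift, chainShift, ← Fin.succ_castSucc, Fin.partialSum_succ', Fin.sum_univ_succ,
    Fin.tail_def]
  ring

theorem pairSum_weightForm_ofFn {ι : Type*} (x : ι → ℝ) (z : ι → ℂ) (v : Fin m → ι) :
    pairSum (weightForm (fun j => (x j : ℂ)) z) (List.ofFn v) =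
      ∑ k, (x (v k) * chainShift (x ∘ v) k : ℝ) * z (v k) := by
  induction m with
  | zero => simp [pairSum]
  | succ m ih =>
    have hhead : ∑ k : Fin m, weightForm (fun j => (x j : ℂ)) z (v 0) (v k.succ) =
        (x (v 0) * chainShift (x ∘ v) 0 : ℝ) * z (v 0) -
          ∑ k : Fin m, (x (v k.succ) * (x (v 0) / 2) : ℝ) * z (v k.succ) := by
      rw [chainShift_zero, Finset.sum_div, Finset.mul_sum, Complex.ofReal_sum, Finset.sum_mul,
        ← Finset.sum_sub_distrib]
      refine Finset.sum_congr rfl fun k _ => ?_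
      simp only [weightForm, Function.comp_apply]
      push_cast
      ring
    rw [List.ofFn_succ, pairSum, List.map_ofFn, List.sum_ofFn]
    simp only [Function.comp_def] at hhead ih ⊢
    rw [hhead, ih, Fin.sum_univ_succ, sub_add_eq_add_sub, add_sub_assoc, ← Finset.sum_sub_distrib]
    simp only [chainShift_succ, mul_sub, sub_mul, Complex.ofReal_sub]

theorem sum_mul_chainShift_sq (y : Fin m → ℝ) :
    ∑ k, y k * chainShift y k ^ 2 = ((∑ k, y k) ^ 3 - ∑ k, y k ^ 3) / 12 := by
  have htelescope := sum_succ_sub_castSucc fun k => -((∑ l, y l) / 2 - Fin.partialSum y k) ^ 3 / 3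
  simp only [partialSum_last, Fin.partialSum_zero, Fin.partialSum_succ] at htelescope
  have hcube (k : Fin m) : y k * chainShift y k ^ 2 =
      (-((∑ l, y l) / 2 - (Fin.partialSum y k.castSucc + y k)) ^ 3 / 3 -
        -((∑ l, y l) / 2 - Fin.partialSum y k.castSucc) ^ 3 / 3) - y k ^ 3 / 12 := by
    unfold chainShift
    ring
  simp_rw [hcube]
  rw [Finset.sum_sub_distrib, htelescope, ← Finset.sum_div]
  ring

/-- The increments of the path `0, s₁, …, s_m, 0`. -/
def loopIncrement (s : Fin m → ℝ) (k : Fin (m + 1)) : ℝ :=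
  (Fin.snoc s 0 : Fin (m + 1) → ℝ) k - (Fin.cons 0 s : Fin (m + 1) → ℝ) k

theorem sum_chainShift_mul_loopIncrement (y : Fin (m + 1) → ℝ) (s : Fin m → ℝ) :
    ∑ k, chainShift y k * loopIncrement s k =
      ∑ k, ((Fin.cons 0 s : Fin (m + 1) → ℝ) k + (Fin.snoc s 0 : Fin (m + 1) → ℝ) k) * y k / 2 := by
  have htelescope := sum_succ_sub_castSucc fun k =>
    (Fin.cons 0 (Fin.snoc s 0 : Fin (m + 1) → ℝ) : Fin (m + 2) → ℝ) k *
      ((∑ l, y l) / 2 - Fin.partialSum y k)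
  have hcastSucc (k : Fin (m + 1)) :
      (Fin.cons 0 (Fin.snoc s 0 : Fin (m + 1) → ℝ) : Fin (m + 2) → ℝ) k.castSucc =
        (Fin.cons 0 s : Fin (m + 1) → ℝ) k := by
    rw [Fin.cons_snoc_eq_snoc_cons, Fin.snoc_castSucc]
  simp only [Fin.partialSum_succ, Fin.cons_zero, Fin.cons_succ, hcastSucc] at htelescope
  rw [← Fin.succ_last, Fin.cons_succ, Fin.snoc_last, zero_mul, zero_mul, sub_zero] at htelescope
  rw [← sub_eq_zero, ← Finset.sum_sub_distrib]
  refine (Finset.sum_congr rfl fun k _ => ?_).trans htelescope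
  unfold chainShift loopIncrement
  ring

theorem sqrt_mul_airyKernel {y : ℝ} (hy : 0 < y) (r t : ℝ) :
    Real.sqrt (2 * Real.pi * y) * airyKernel y r t =
      Real.exp (y ^ 3 / 24 + (-(r - t) ^ 2 / (2 * y) - (r + t) * y / 2)) := by
  have hsqrt : Real.sqrt (2 * Real.pi * y) ≠ 0 := by positivity
  rw [airyKernel, Real.exp_add]
  field_simp

/-- Completing the square: the Gaussian factors left over by the Fourier integrals are Airy heat
kernels along the closed path `s`. -/
theorem prod_exp_chainShift {y : Fin (m + 1) → ℝ} (hy : ∀ k, 0 < y k) (s : Fin m → ℝ) :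
    ∏ k, Real.exp (-y k * (chainShift y k + loopIncrement s k / y k) ^ 2 / 2) =
      Real.exp (-(∑ k, y k) ^ 3 / 24) * (∏ k, Real.sqrt (2 * Real.pi * y k)) *
        ∏ k, airyKernel (y k) ((Fin.cons 0 s : Fin (m + 1) → ℝ) k)
          ((Fin.snoc s 0 : Fin (m + 1) → ℝ) k) := by
  have hsq (k : Fin (m + 1)) : -y k * (chainShift y k + loopIncrement s k / y k) ^ 2 / 2 =
      -(y k * chainShift y k ^ 2) / 2 - chainShift y k * loopIncrement s k +
        -((Fin.cons 0 s : Fin (m + 1) → ℝ) k - (Fin.snoc s 0 : Fin (m + 1) → ℝ) k) ^ 2 /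
          (2 * y k) := by
    have := (hy k).ne'
    unfold loopIncrement
    field_simp
    ring
  rw [mul_assoc, ← Finset.prod_mul_distrib]
  simp_rw [sqrt_mul_airyKernel (hy _)]
  rw [← Real.exp_sum, ← Real.exp_sum, ← Real.exp_add]
  simp_rw [hsq, Finset.sum_add_distrib, Finset.sum_sub_distrib]
  rw [sum_chainShift_mul_loopIncrement, ← Finset.sum_div, Finset.sum_neg_distrib,
    sum_mul_chainShift_sq, ← Finset.sum_div _ _ (24 : ℝ)]
  congr 1
  ring

/-- The matrix of the linear forms `a_q / y_q - a_{q+1} / y_{q+1}`. -/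
def chainMatrix (y : Fin (m + 1) → ℝ) : Matrix (Fin m) (Fin (m + 1)) ℝ := fun q =>
  Pi.single q.castSucc (y q.castSucc)⁻¹ - Pi.single q.succ (y q.succ)⁻¹

theorem chainMatrix_mulVec (y a : Fin (m + 1) → ℝ) (q : Fin m) :
    (chainMatrix y *ᵥ a) q = a q.castSucc / y q.castSucc - a q.succ / y q.succ := by
  change (Pi.single _ _ - Pi.single _ _) ⬝ᵥ a = _
  rw [sub_dotProduct, single_dotProduct, single_dotProduct, div_eq_inv_mul, div_eq_inv_mul]

theorem vecMul_chainMatrix (y : Fin (m + 1) → ℝ) (s : Fin m → ℝ) (k : Fin (m + 1)) :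
    (s ᵥ* chainMatrix y) k = loopIncrement s k / y k := by
  simp only [chainMatrix, Matrix.vecMul, dotProduct, loopIncrement, Pi.sub_apply, mul_sub,
    Finset.sum_sub_distrib, sub_div, Pi.single_apply, mul_ite, mul_zero]
  congr 1
  · refine Fin.lastCases ?_ (fun j => ?_) k
    · simp [fun q : Fin m => (Fin.castSucc_ne_last q).symm]
    · simp [div_eq_mul_inv]
  · refine Fin.cases ?_ (fun j => ?_) k
    · simp [fun q : Fin m => (Fin.succ_ne_zero q).symm]
    · simp [div_eq_mul_inv]

theorem measurePreserving_comp_perm {κ : Type*} [Fintype κ] (σ : Equiv.Perm κ) :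
    MeasurePreserving (MeasurableEquiv.arrowCongr' σ.symm (MeasurableEquiv.refl ℝ)) :=
  volume_preserving_arrowCongr' σ.symm (MeasurableEquiv.refl ℝ) (MeasurePreserving.id _)

theorem integral_comp_perm {κ E : Type*} [Fintype κ] [NormedAddCommGroup E] [NormedSpace ℝ E]
    (σ : Equiv.Perm κ) (f : (κ → ℝ) → E) : ∫ a : κ → ℝ, f (a ∘ σ) = ∫ a, f a :=
  (measurePreserving_comp_perm σ).integral_comp' f

theorem integrable_comp_perm {κ E : Type*} [Fintype κ] [NormedAddCommGroup E] (σ : Equiv.Perm κ)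
    {f : (κ → ℝ) → E} (hf : Integrable f) : Integrable fun a : κ → ℝ => f (a ∘ σ) :=
  (measurePreserving_comp_perm σ).integrable_comp_emb (MeasurableEquiv.measurableEmbedding _) |>.2
    hf

end LinearChain

/-! ### The regularised Gaussian integral -/

section ShiftedPoint

variable {n : ℕ} {x : Fin n → ℝ}

/-- The points `i a_j / x_j + ε j`, whose real parts are distinct for `ε ≠ 0`. -/
def shiftedPoint (x a : Fin n → ℝ) (ε : ℝ) (j : Fin n) : ℂ :=
  Complex.I * (a j / x j : ℝ) + (ε * (j : ℕ) : ℝ)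

theorem shiftedPoint_sub (a : Fin n → ℝ) (ε : ℝ) (i j : Fin n) :
    shiftedPoint x a ε i - shiftedPoint x a ε j =
      Complex.I * (a i / x i - a j / x j : ℝ) + (ε * ((i : ℕ) - (j : ℕ) : ℝ) : ℝ) := by
  simp only [shiftedPoint]
  push_cast
  ring

theorem measurable_shiftedPoint (x : Fin n → ℝ) (ε : ℝ) (j : Fin n) :
    Measurable fun a => shiftedPoint x a ε j := by
  unfold shiftedPoint
  fun_prop

theorem tendsto_shiftedPoint (x a : Fin n → ℝ) (j : Fin n) :
    Tendsto (fun ε => shiftedPoint x a ε j) (𝓝[>] 0) (𝓝 (shiftedPoint x a 0 j)) := by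
  have hcont : Continuous fun ε => shiftedPoint x a ε j := by
    unfold shiftedPoint
    fun_prop
  exact (hcont.tendsto 0).mono_left nhdsWithin_le_nhds

theorem shiftedPoint_zero (x a : Fin n → ℝ) :
    shiftedPoint x a 0 = (fun j => Complex.I * (a j : ℂ)) / fun j => (x j : ℂ) := by
  funext j
  simp [shiftedPoint, mul_div_assoc]

theorem shiftedPoint_injective_of_ne_zero (a : Fin n → ℝ) {ε : ℝ} (hε : ε ≠ 0) :
    Function.Injective (shiftedPoint x a ε) := by
  intro i j h
  have hre := congrArg Complex.re h
  simp only [shiftedPoint, Complex.add_re, Complex.I_mul_re, Complex.ofReal_re, Complex.ofReal_im,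
    neg_zero, zero_add] at hre
  exact Fin.ext (by exact_mod_cast mul_left_cancel₀ hε hre)

theorem shiftedPoint_zero_injective {a : Fin n → ℝ} (ha : Function.Injective (a / x)) :
    Function.Injective (shiftedPoint x a 0) := by
  intro i j h
  have him := congrArg Complex.im h
  simp only [shiftedPoint, Complex.add_im, Complex.I_mul_im, Complex.ofReal_re, Complex.ofReal_im,
    add_zero] at him
  exact ha him

theorem abs_re_weightForm_shiftedPoint_le (x a : Fin n → ℝ) {ε : ℝ} (hε : ε ∈ Set.Icc 0 1)
    (i j : Fin n) :
    |(weightForm (fun j => (x j : ℂ)) (shiftedPoint x a ε) i j).re| ≤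
      ∑ p : Fin n × Fin n, |x p.1 * x p.2 * ((p.1 : ℕ) - (p.2 : ℕ) : ℝ) / 2| := by
  have hform : weightForm (fun j => (x j : ℂ)) (shiftedPoint x a ε) i j =
      (ε * (x i * x j * ((i : ℕ) - (j : ℕ) : ℝ) / 2) : ℝ) +
        (x i * x j * (a i / x i - a j / x j) / 2 : ℝ) * Complex.I := by
    rw [weightForm, shiftedPoint_sub]
    push_cast
    ring
  rw [hform, Complex.add_re, Complex.ofReal_re, Complex.re_ofReal_mul, Complex.I_re, mul_zero,
    add_zero, abs_mul, abs_of_nonneg hε.1]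
  exact (mul_le_of_le_one_left (abs_nonneg _) hε.2).trans
    (Finset.single_le_sum (f := fun p : Fin n × Fin n =>
      |x p.1 * x p.2 * ((p.1 : ℕ) - (p.2 : ℕ) : ℝ) / 2|) (fun _ _ => abs_nonneg _)
      (Finset.mem_univ (i, j)))

end ShiftedPoint

section OrderedTerm

variable {m : ℕ} {x : Fin (m + 1) → ℝ}

/-- The weight of a pair of neighbours: `-1` on `[0, ∞)` for an ascent, `1` on `(-∞, 0]` for a
descent. -/
def stepWeight {n : ℕ} (i j : Fin n) : ℝ → ℝ := halfLineWeight ((i : ℕ) - (j : ℕ))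

theorem isUnitWeight_stepWeight {n : ℕ} (i j : Fin n) : IsUnitWeight (stepWeight i j) :=
  isUnitWeight_halfLineWeight _

/-- The summand of `symSum` for the order `σ` at the shifted points, with its Gaussian weight. -/
def orderedTerm (x : Fin (m + 1) → ℝ) (ε : ℝ) (σ : Equiv.Perm (Fin (m + 1)))
    (a : Fin (m + 1) → ℝ) : ℂ :=
  gaussianWeight x a *
    (Complex.exp (pairSum (weightForm (fun j => (x j : ℂ)) (shiftedPoint x a ε)) (List.ofFn σ)) *
      chainProd (shiftedPoint x a ε) (List.ofFn σ))

/-- The part of the exponent of `orderedTerm x ε σ` due to the shift, divided by `ε`. -/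
def shiftExponent (x : Fin (m + 1) → ℝ) (σ : Equiv.Perm (Fin (m + 1))) : ℝ :=
  ∑ k, x (σ k) * chainShift (x ∘ σ) k * (σ k : ℕ)

/-- The real part of the `q`-th denominator of `orderedTerm x ε σ`. -/
def stepShift (ε : ℝ) (σ : Equiv.Perm (Fin (m + 1))) (q : Fin m) : ℝ :=
  ε * ((σ q.castSucc : ℕ) - (σ q.succ : ℕ))

theorem stepShift_ne_zero {ε : ℝ} (hε : ε ≠ 0) (σ : Equiv.Perm (Fin (m + 1))) (q : Fin m) :
    stepShift ε σ q ≠ 0 := by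
  refine mul_ne_zero hε (sub_ne_zero.2 fun h => ?_)
  exact (Fin.castSucc_lt_succ (i := q)).ne (σ.injective (Fin.ext (by exact_mod_cast h)))

theorem pairSum_weightForm_shiftedPoint (hx : ∀ i, 0 < x i) (σ : Equiv.Perm (Fin (m + 1)))
    (ε : ℝ) (a : Fin (m + 1) → ℝ) :
    pairSum (weightForm (fun j => (x j : ℂ)) (shiftedPoint x a ε)) (List.ofFn σ) =
      (ε * shiftExponent x σ : ℝ) + Complex.I * (chainShift (x ∘ σ) ⬝ᵥ (a ∘ σ) : ℝ) := by
  rw [pairSum_weightForm_ofFn, shiftExponent, dotProduct]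
  push_cast
  rw [Finset.mul_sum, Finset.mul_sum, ← Finset.sum_add_distrib]
  refine Finset.sum_congr rfl fun k _ => ?_
  have : (x (σ k) : ℂ) ≠ 0 := by exact_mod_cast (hx _).ne'
  simp only [shiftedPoint, Function.comp_apply]
  push_cast
  field_simp
  ring

theorem orderedTerm_eq (hx : ∀ i, 0 < x i) (ε : ℝ) (σ : Equiv.Perm (Fin (m + 1)))
    (a : Fin (m + 1) → ℝ) :
    orderedTerm x ε σ a = Real.exp (ε * shiftExponent x σ) *
      gaussianFractions (x ∘ σ) (chainShift (x ∘ σ)) (chainMatrix (x ∘ σ)) (stepShift ε σ)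
        (a ∘ σ) := by
  simp only [orderedTerm, gaussianFractions, gaussianWeight_comp_perm, chainMatrix_mulVec,
    pairSum_weightForm_shiftedPoint hx, Complex.exp_add, chainProd_ofFn, shiftedPoint_sub,
    stepShift, Function.comp_apply, Complex.ofReal_exp]
  ring

theorem integrable_orderedTerm (hx : ∀ i, 0 < x i) {ε : ℝ} (hε : ε ≠ 0)
    (σ : Equiv.Perm (Fin (m + 1))) : Integrable (orderedTerm x ε σ) := by
  rw [funext (orderedTerm_eq hx ε σ)]
  exact (integrable_comp_perm σ (integrable_gaussianFractions _ _ (fun _ => hx _)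
    (stepShift_ne_zero hε σ))).const_mul _

/-- The integral of the path integrand against the exponential factors `e^{s_q δ_q}`, where `δ_q`
is `stepShift ε σ q`; it tends to the path integral as `ε → 0`. -/
def dampedPathIntegral (x : Fin (m + 1) → ℝ) (ε : ℝ) (σ : Equiv.Perm (Fin (m + 1))) : ℝ :=
  ∫ s, (∏ q, Real.exp (s q * stepShift ε σ q)) * pathIntegrand x stepWeight σ 0 s

theorem integral_orderedTerm (hx : ∀ i, 0 < x i) {ε : ℝ} (hε : 0 < ε)
    (σ : Equiv.Perm (Fin (m + 1))) :
    ∫ a, orderedTerm x ε σ a = (Real.exp (ε * shiftExponent x σ) *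
      (Real.exp (-(∑ k, x k) ^ 3 / 24) * (∏ k, Real.sqrt (2 * Real.pi * x k)) ^ 2 *
        dampedPathIntegral x ε σ) : ℝ) := by
  have hxσ (k : Fin (m + 1)) : 0 < (x ∘ σ) k := hx _
  have hweight (s : Fin m → ℝ) :
      ∏ q, halfLineWeight (stepShift ε σ q) (s q) * Real.exp (s q * stepShift ε σ q) =
        (∏ q, Real.exp (s q * stepShift ε σ q)) *
          ∏ q : Fin m, stepWeight (σ q.castSucc) (σ q.succ) (s q) := by
    rw [← Finset.prod_mul_distrib]
    refine Finset.prod_congr rfl fun q _ => ?_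
    rw [stepShift, halfLineWeight_const_mul hε, stepWeight, mul_comm]
  have hsum : ∑ k, (x ∘ σ) k = ∑ k, x k := Equiv.sum_comp σ x
  have hprod : ∏ k, Real.sqrt (2 * Real.pi * (x ∘ σ) k) = ∏ k, Real.sqrt (2 * Real.pi * x k) :=
    Equiv.prod_comp σ fun k => Real.sqrt (2 * Real.pi * x k)
  rw [funext (orderedTerm_eq hx ε σ), integral_const_mul, integral_comp_perm σ,
    integral_gaussianFractions _ _ hxσ (stepShift_ne_zero hε.ne' σ),
    ← Complex.ofReal_mul, dampedPathIntegral]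
  congr 2
  rw [← integral_const_mul, ← integral_const_mul]
  refine integral_congr_ae (ae_of_all _ fun s => ?_)
  simp only [Pi.add_apply, vecMul_chainMatrix]
  rw [prod_exp_chainShift hxσ, hsum, hprod, hweight, pathIntegrand]
  simp only [Function.comp_apply]
  ring

theorem abs_prod_exp_mul_pathIntegrand_le {ε : ℝ} (hε : 0 < ε) (σ : Equiv.Perm (Fin (m + 1)))
    (s : Fin m → ℝ) :
    |(∏ q, Real.exp (s q * stepShift ε σ q)) * pathIntegrand x stepWeight σ 0 s| ≤
      |pathIntegrand x stepWeight σ 0 s| := by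
  rw [pathIntegrand, ← mul_assoc, ← Finset.prod_mul_distrib, abs_mul, abs_mul]
  simp only [Finset.abs_prod]
  refine mul_le_mul_of_nonneg_right (Finset.prod_le_prod (fun _ _ => abs_nonneg _) fun q _ => ?_)
    (Finset.prod_nonneg fun _ _ => abs_nonneg _)
  rw [mul_comm, stepWeight, ← halfLineWeight_const_mul hε]
  exact abs_halfLineWeight_mul_exp_le _ _

theorem tendsto_dampedPathIntegral (hx : ∀ i, 0 < x i) (σ : Equiv.Perm (Fin (m + 1))) :
    Tendsto (fun ε => dampedPathIntegral x ε σ) (𝓝[>] 0)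
      (𝓝 (pathIntegral x stepWeight (List.ofFn σ) 0)) := by
  obtain ⟨hintegrable, hintegral⟩ :=
    integrable_and_integral_pathIntegrand hx isUnitWeight_stepWeight σ 0
  rw [← hintegral]
  refine tendsto_integral_filter_of_dominated_convergence
    (fun s => |pathIntegrand x stepWeight σ 0 s|) ?_ ?_ hintegrable.abs ?_
  · refine Eventually.of_forall fun ε => ?_
    exact Measurable.aestronglyMeasurable (by fun_prop) |>.mul hintegrable.aestronglyMeasurable
  · filter_upwards [self_mem_nhdsWithin] with ε hε
    exact ae_of_all _ fun s => abs_prod_exp_mul_pathIntegrand_le hε σ s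
  · refine ae_of_all _ fun s => ?_
    have hcont : Continuous fun ε =>
        (∏ q, Real.exp (s q * stepShift ε σ q)) * pathIntegrand x stepWeight σ 0 s := by
      unfold stepShift
      fun_prop
    simpa [stepShift] using (hcont.tendsto 0).mono_left (nhdsWithin_le_nhds (s := Set.Ioi 0))

theorem tendsto_integral_orderedTerm (hx : ∀ i, 0 < x i) (σ : Equiv.Perm (Fin (m + 1))) :
    Tendsto (fun ε => ∫ a, orderedTerm x ε σ a) (𝓝[>] 0)
      (𝓝 ((Real.exp (-(∑ k, x k) ^ 3 / 24) * (∏ k, Real.sqrt (2 * Real.pi * x k)) ^ 2 *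
        pathIntegral x stepWeight (List.ofFn σ) 0 : ℝ) : ℂ)) := by
  have hexp : Tendsto (fun ε => Real.exp (ε * shiftExponent x σ)) (𝓝[>] 0) (𝓝 1) := by
    have hcont : Continuous fun ε => Real.exp (ε * shiftExponent x σ) := by fun_prop
    simpa using (hcont.tendsto 0).mono_left (nhdsWithin_le_nhds (s := Set.Ioi 0))
  have hlim := hexp.mul ((tendsto_dampedPathIntegral hx σ).const_mul
    (Real.exp (-(∑ k, x k) ^ 3 / 24) * (∏ k, Real.sqrt (2 * Real.pi * x k)) ^ 2))
  rw [one_mul] at hlim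
  refine ((Complex.continuous_ofReal.tendsto _).comp hlim).congr' ?_
  filter_upwards [self_mem_nhdsWithin] with ε hε
  exact (integral_orderedTerm hx hε σ).symm

end OrderedTerm

/-! ### The limit of vanishing shift -/

section Limit

variable {ι α : Type*} {z : α → ι → ℂ} {ω : α → ι → ι → ℂ}

theorem measurable_chainProd [MeasurableSpace α] (hz : ∀ i, Measurable fun a => z a i)
    (l : List ι) : Measurable fun a => chainProd (z a) l := by
  induction l with
  | nil => exact measurable_const
  | cons i l ih =>
    match l, ih with
    | [], _ => exact measurable_const
    | j :: l, ih => exact ((hz i).sub (hz j)).inv.mul ih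

theorem measurable_pairSum [MeasurableSpace α] (hω : ∀ i j, Measurable fun a => ω a i j)
    (l : List ι) : Measurable fun a => pairSum (ω a) l := by
  induction l with
  | nil => exact measurable_const
  | cons i l ih =>
    refine Measurable.add ?_ ih
    simp only [← Fin.sum_univ_fun_getElem]
    fun_prop

theorem measurable_symSum [MeasurableSpace α] (hz : ∀ i, Measurable fun a => z a i)
    (hω : ∀ i j, Measurable fun a => ω a i j) (S : Finset ι) :
    Measurable fun a => symSum (ω a) (z a) S :=
  Finset.measurable_sum _ fun l _ =>
    (Complex.measurable_exp.comp (measurable_pairSum hω l)).mul (measurable_chainProd hz l)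

variable {F : Filter α} {z₀ : ι → ℂ} {ω₀ : ι → ι → ℂ}

theorem tendsto_chainProd (hz : ∀ i, Tendsto (fun a => z a i) F (𝓝 (z₀ i)))
    (hz₀ : Function.Injective z₀) {l : List ι} (hl : l.Nodup) :
    Tendsto (fun a => chainProd (z a) l) F (𝓝 (chainProd z₀ l)) := by
  induction l with
  | nil => exact tendsto_const_nhds
  | cons i l ih =>
    match l, ih, hl with
    | [], _, _ => exact tendsto_const_nhds
    | j :: l, ih, hl =>
      have hij : i ≠ j := fun h => by simp [h] at hl
      exact (((hz i).sub (hz j)).inv₀ (sub_ne_zero.2 (hz₀.ne hij))).mul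
        (ih (List.nodup_cons.1 hl).2)

theorem tendsto_pairSum (hω : ∀ i j, Tendsto (fun a => ω a i j) F (𝓝 (ω₀ i j))) (l : List ι) :
    Tendsto (fun a => pairSum (ω a) l) F (𝓝 (pairSum ω₀ l)) := by
  induction l with
  | nil => exact tendsto_const_nhds
  | cons i l ih => exact (tendsto_list_sum l fun j _ => hω i j).add ih

theorem tendsto_symSum (hz : ∀ i, Tendsto (fun a => z a i) F (𝓝 (z₀ i)))
    (hz₀ : Function.Injective z₀) (hω : ∀ i j, Tendsto (fun a => ω a i j) F (𝓝 (ω₀ i j)))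
    (S : Finset ι) : Tendsto (fun a => symSum (ω a) (z a) S) F (𝓝 (symSum ω₀ z₀ S)) :=
  tendsto_finsetSum _ fun l hl =>
    ((Complex.continuous_exp.tendsto _).comp (tendsto_pairSum hω l)).mul
      (tendsto_chainProd hz hz₀ (nodup_of_mem_orderings hl))

end Limit

theorem ae_div_ne {ι : Type*} [Fintype ι] {x : ι → ℝ} {i j : ι} (hij : i ≠ j) (hi : x i ≠ 0) :
    ∀ᵐ a : ι → ℝ, a i / x i ≠ a j / x j := by
  classical
  let L : (ι → ℝ) →ₗ[ℝ] ℝ := (x i)⁻¹ • LinearMap.proj i - (x j)⁻¹ • LinearMap.proj j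
  have hL (a : ι → ℝ) : L a = a i / x i - a j / x j := by simp [L, div_eq_inv_mul]
  have hne : LinearMap.ker L ≠ ⊤ := fun htop => by
    have hmem : Pi.single i (1 : ℝ) ∈ LinearMap.ker L := htop ▸ Submodule.mem_top
    rw [LinearMap.mem_ker, hL] at hmem
    simp [hij.symm, hi] at hmem
  rw [ae_iff]
  refine measure_mono_null (fun a ha => ?_) (Measure.addHaar_submodule volume _ hne)
  rw [SetLike.mem_coe, LinearMap.mem_ker, hL, sub_eq_zero]
  exact not_not.1 ha

theorem ae_injective_div {ι : Type*} [Fintype ι] {x : ι → ℝ} (hx : ∀ i, x i ≠ 0) :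
    ∀ᵐ a : ι → ℝ, Function.Injective (a / x) := by
  have hpair : ∀ᵐ a : ι → ℝ, ∀ i j, i ≠ j → a i / x i ≠ a j / x j := by
    simp only [ae_all_iff]
    exact fun i j hij => ae_div_ne hij (hx i)
  filter_upwards [hpair] with a ha i j hij
  exact not_not.1 fun hne => ha i j hne hij

section SymmetricIntegrand

variable {n : ℕ} {x : Fin n → ℝ}

/-- The Gaussian weight times the symmetrized sum at the shifted points; at `ε = 0` this is
Buryak's integrand up to the factor `∏ x_j`. -/
def symmetricIntegrand (x : Fin n → ℝ) (ε : ℝ) (a : Fin n → ℝ) : ℂ :=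
  gaussianWeight x a *
    symSum (weightForm (fun j => (x j : ℂ)) (shiftedPoint x a ε)) (shiftedPoint x a ε) Finset.univ

theorem symmetricIntegrand_eq_sum {m : ℕ} (x : Fin (m + 1) → ℝ) (ε : ℝ) (a : Fin (m + 1) → ℝ) :
    symmetricIntegrand x ε a = ∑ σ, orderedTerm x ε σ a := by
  rw [symmetricIntegrand, symSum, sum_orderings_univ, Finset.mul_sum]
  rfl

theorem measurable_symmetricIntegrand (x : Fin n → ℝ) (ε : ℝ) :
    Measurable (symmetricIntegrand x ε) := by
  have hz := measurable_shiftedPoint x ε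
  refine Measurable.mul (by fun_prop) (measurable_symSum hz (fun i j => ?_) _)
  unfold weightForm
  exact (((hz i).sub (hz j)).const_mul _).div_const _

theorem exists_norm_symmetricIntegrand_le (x : Fin n → ℝ) :
    ∃ C, ∀ ε ∈ Set.Icc (0 : ℝ) 1, ∀ a, Function.Injective (shiftedPoint x a ε) →
      ‖symmetricIntegrand x ε a‖ ≤ gaussianWeight x a * C := by
  obtain ⟨C, hC⟩ := exists_norm_symSum_le (fun j => (x j : ℂ))
    (∑ p : Fin n × Fin n, |x p.1 * x p.2 * ((p.1 : ℕ) - (p.2 : ℕ) : ℝ) / 2|) Finset.univ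
  refine ⟨C, fun ε hε a ha => ?_⟩
  have hnonneg : 0 ≤ gaussianWeight x a := Finset.prod_nonneg fun _ _ => (Real.exp_pos _).le
  have hbound := hC _ ha (abs_re_weightForm_shiftedPoint_le x a hε) 1 (by simp)
  rw [symmetricIntegrand, norm_mul, Complex.norm_real, Real.norm_of_nonneg hnonneg]
  exact mul_le_mul_of_nonneg_left (by simpa only [Complex.ofReal_one, one_mul] using hbound) hnonneg

theorem integrable_symmetricIntegrand_zero (hx : ∀ i, 0 < x i) :
    Integrable (symmetricIntegrand x 0) := by
  obtain ⟨C, hC⟩ := exists_norm_symmetricIntegrand_le x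
  refine ((integrable_gaussianWeight hx).mul_const C).mono'
    (measurable_symmetricIntegrand x 0).aestronglyMeasurable ?_
  filter_upwards [ae_injective_div fun i => (hx i).ne'] with a ha
  exact hC 0 (by simp) a (shiftedPoint_zero_injective ha)

theorem tendsto_integral_symmetricIntegrand (hx : ∀ i, 0 < x i) :
    Tendsto (fun ε => ∫ a, symmetricIntegrand x ε a) (𝓝[>] 0)
      (𝓝 (∫ a, symmetricIntegrand x 0 a)) := by
  obtain ⟨C, hC⟩ := exists_norm_symmetricIntegrand_le x
  refine tendsto_integral_filter_of_dominated_convergence (fun a => gaussianWeight x a * C)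
    (Eventually.of_forall fun ε => (measurable_symmetricIntegrand x ε).aestronglyMeasurable) ?_
    ((integrable_gaussianWeight hx).mul_const C) ?_
  · filter_upwards [Ioc_mem_nhdsGT (zero_lt_one' ℝ)] with ε hε
    exact ae_of_all _ fun a =>
      hC ε (Set.Ioc_subset_Icc_self hε) a (shiftedPoint_injective_of_ne_zero a hε.1.ne')
  · filter_upwards [ae_injective_div fun i => (hx i).ne'] with a ha
    have hz := tendsto_shiftedPoint x a
    exact (tendsto_symSum hz (shiftedPoint_zero_injective ha)
      (fun i j => (((hz i).sub (hz j)).const_mul _).div_const _) _).const_mul _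

theorem integral_symmetricIntegrand_zero {m : ℕ} {x : Fin (m + 1) → ℝ} (hx : ∀ i, 0 < x i) :
    ∫ a, symmetricIntegrand x 0 a =
      (Real.exp (-(∑ k, x k) ^ 3 / 24) * (∏ k, Real.sqrt (2 * Real.pi * x k)) ^ 2 *
        ∑ l ∈ orderings Finset.univ, pathIntegral x stepWeight l 0 : ℝ) := by
  refine tendsto_nhds_unique (tendsto_integral_symmetricIntegrand hx) ?_
  rw [sum_orderings_univ, Finset.mul_sum, Complex.ofReal_sum]
  refine (tendsto_finsetSum _ fun σ _ => tendsto_integral_orderedTerm hx σ).congr' ?_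
  filter_upwards [self_mem_nhdsWithin] with ε (hε : 0 < ε)
  rw [← integral_finsetSum _ fun σ _ => integrable_orderedTerm hx hε.ne' σ]
  simp_rw [symmetricIntegrand_eq_sum]

theorem buryakIntegrand_ae_eq (hn : 1 ≤ n) (hx : ∀ i, 0 < x i) :
    buryakIntegrand n x =ᵐ[volume] fun a => ((∏ j, x j : ℝ) : ℂ)⁻¹ * symmetricIntegrand x 0 a := by
  have hx' (i : Fin n) : x i ≠ 0 := (hx i).ne'
  filter_upwards [ae_injective_div hx'] with a ha
  have hinj := shiftedPoint_zero_injective ha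
  rw [shiftedPoint_zero] at hinj
  rw [buryakIntegrand, buryakP_eq_symSum hn (fun i => Complex.ofReal_ne_zero.2 (hx' i)) hinj,
    symmetricIntegrand, shiftedPoint_zero, Complex.ofReal_prod _ x, gaussianWeight, mul_left_comm]

theorem integrable_buryakIntegrand (hn : 1 ≤ n) (hx : ∀ i, 0 < x i) :
    Integrable (buryakIntegrand n x) :=
  ((integrable_symmetricIntegrand_zero hx).const_mul _).congr (buryakIntegrand_ae_eq hn hx).symm

theorem prod_sqrt_two_pi_mul (hx : ∀ i, 0 < x i) :
    ∏ k, Real.sqrt (2 * Real.pi * x k) =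
      (2 * Real.pi) ^ ((n : ℝ) / 2) / (∏ k, Real.sqrt (x k)) * ∏ k, x k := by
  have hsqrt : ∏ k, Real.sqrt (x k) ≠ 0 :=
    Finset.prod_ne_zero_iff.2 fun k _ => (Real.sqrt_pos.2 (hx k)).ne'
  have hprod : ∏ k, x k = (∏ k, Real.sqrt (x k)) * ∏ k, Real.sqrt (x k) := by
    rw [← Finset.prod_mul_distrib]
    exact Finset.prod_congr rfl fun k _ => (Real.mul_self_sqrt (hx k).le).symm
  have hconst : Real.sqrt (2 * Real.pi) ^ n = (2 * Real.pi) ^ ((n : ℝ) / 2) := by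
    rw [Real.sqrt_eq_rpow, ← Real.rpow_mul_natCast (by positivity)]
    ring_nf
  simp_rw [Real.sqrt_mul (by positivity : (0 : ℝ) ≤ 2 * Real.pi)]
  rw [Finset.prod_mul_distrib, Finset.prod_const, Finset.card_univ, Fintype.card_fin, hconst,
    hprod]
  field_simp

theorem buryakF_eq (hn : 1 ≤ n) (hx : ∀ i, 0 < x i) :
    buryakF n x =
      ((2 * Real.pi) ^ ((n : ℝ) / 2) / ∏ j, Real.sqrt (x j) : ℝ) *
        ((∑ j, x j)⁻¹ * ∑ l ∈ orderings Finset.univ, pathIntegral x stepWeight l 0 : ℝ) := by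
  obtain ⟨m, rfl⟩ := Nat.exists_eq_add_of_le' hn
  have hprod : ∏ k, x k ≠ 0 := (Finset.prod_pos fun k _ => hx k).ne'
  have hsqrt : ∏ k, Real.sqrt (2 * Real.pi * x k) ≠ 0 :=
    Finset.prod_ne_zero_iff.2 fun k _ =>
      (Real.sqrt_pos.2 (mul_pos (by positivity) (hx k))).ne'
  have hexp : Real.exp (-(∑ k, x k) ^ 3 / 24) = (Real.exp ((∑ k, x k) ^ 3 / 24))⁻¹ := by
    rw [← Real.exp_neg, neg_div]
  rw [buryakF, integral_congr_ae (buryakIntegrand_ae_eq hn hx), integral_const_mul,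
    integral_symmetricIntegrand_zero hx, ← Complex.ofReal_inv, ← Complex.ofReal_mul,
    ← Complex.ofReal_mul, ← Complex.ofReal_mul,
    (div_eq_iff hprod).2 (prod_sqrt_two_pi_mul hx) |>.symm, hexp]
  congr 1
  field_simp

end SymmetricIntegrand

/-! ### Merging the steps with opposite weights -/

section HeadIntegral

variable {ι : Type*} {x : ι → ℝ} {h : ι → ι → ℝ → ℝ}

/-- The variant of `pathIntegral` in which the first kernel and the first weight are prescribed. -/
def headIntegral (x : ι → ℝ) (h : ι → ι → ℝ → ℝ) (y : ℝ) (g : ι → ℝ → ℝ) : List ι → ℝ → ℝ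
  | [], r => airyKernel y r 0
  | j :: l, r => ∫ s, g j s * (airyKernel y r s * pathIntegral x h (j :: l) s)

theorem pathIntegral_cons (x : ι → ℝ) (h : ι → ι → ℝ → ℝ) (i : ι) (l : List ι) (r : ℝ) :
    pathIntegral x h (i :: l) r = headIntegral x h (x i) (h i) l r := by
  cases l <;> rfl

theorem integrable_airyKernel_mul_mul {x y z : ℝ} (hx : 0 < x) (hy : 0 < y) (hz : 0 < z)
    (r t : ℝ) :
    Integrable fun p : ℝ × ℝ =>
      airyKernel x r p.1 * (airyKernel y p.1 p.2 * airyKernel z p.2 t) := by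
  refine (integrable_prod_iff (by fun_prop)).2
    ⟨ae_of_all _ fun s => (integrable_airyKernel_mul hy hz s t).const_mul (airyKernel x r s), ?_⟩
  simp_rw [norm_mul, Real.norm_of_nonneg (airyKernel_nonneg _ _ _), integral_const_mul,
    integral_airyKernel_mul hy hz]
  exact integrable_airyKernel_mul hx (add_pos hy hz) r t

theorem integrable_airyKernel_mul_pathIntegral_step (hx : ∀ i, 0 < x i)
    (hh : ∀ i j, IsUnitWeight (h i j)) {y : ℝ} (hy : 0 < y) (j k : ι) (l : List ι) (r : ℝ) :
    Integrable (fun p : ℝ × ℝ => airyKernel y r p.1 *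
      (h j k p.2 * (airyKernel (x j) p.1 p.2 * pathIntegral x h (k :: l) p.2))) := by
  have hl := measurable_pathIntegral (x := x) hh (k :: l)
  have hw := (hh j k).measurable
  refine (integrable_airyKernel_mul_mul hy (hx j) (sum_map_cons_pos hx k l) r 0).mono'
    (by fun_prop) (ae_of_all _ fun p => ?_)
  rw [norm_mul, Real.norm_of_nonneg (airyKernel_nonneg _ _ _)]
  exact mul_le_mul_of_nonneg_left ((hh j k).norm_mul_airyKernel_mul_le
    (abs_pathIntegral_cons_le hx hh k l p.2) _ _ _) (airyKernel_nonneg _ _ _)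

theorem integral_airyKernel_mul_pathIntegral (hx : ∀ i, 0 < x i)
    (hh : ∀ i j, IsUnitWeight (h i j)) {y : ℝ} (hy : 0 < y) (j : ι) (l : List ι) (r : ℝ) :
    ∫ s, airyKernel y r s * pathIntegral x h (j :: l) s =
      headIntegral x h (y + x j) (h j) l r := by
  match l with
  | [] => exact integral_airyKernel_mul hy (hx j) r 0
  | k :: l =>
    have hsemigroup (t : ℝ) : ∫ s, airyKernel y r s *
          (h j k t * (airyKernel (x j) s t * pathIntegral x h (k :: l) t)) =
        h j k t * (airyKernel (y + x j) r t * pathIntegral x h (k :: l) t) := by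
      rw [← integral_airyKernel_mul hy (hx j), ← integral_mul_const, ← integral_const_mul]
      exact integral_congr_ae (ae_of_all _ fun s => by ring)
    simp_rw [pathIntegral, headIntegral, ← integral_const_mul]
    rw [integral_integral_swap (integrable_airyKernel_mul_pathIntegral_step hx hh hy j k l r)]
    simp_rw [hsemigroup]

end HeadIntegral

section SumBlocks

variable {ι : Type*} [DecidableEq ι]

/-- The sum of `f` over all sequences of `ℓ` nonempty disjoint blocks with union `S`. -/
def sumBlocks : ℕ → Finset ι → (List (Finset ι) → ℝ) → ℝ
  | 0, S, f => if S = ∅ then f [] else 0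
  | ℓ + 1, S, f => ∑ B ∈ S.powerset with B.Nonempty, sumBlocks ℓ (S \ B) fun L => f (B :: L)

theorem integrable_sumBlocks (ℓ : ℕ) (S : Finset ι) {f : List (Finset ι) → ℝ → ℝ}
    (hf : ∀ L, Integrable (f L)) : Integrable fun s => sumBlocks ℓ S fun L => f L s := by
  induction ℓ generalizing S f with
  | zero =>
    simp only [sumBlocks]
    split_ifs
    · exact hf []
    · exact integrable_zero _ _ _
  | succ ℓ ih => exact integrable_finsetSum _ fun B _ => ih (S \ B) fun L => hf (B :: L)

theorem integral_sumBlocks (ℓ : ℕ) (S : Finset ι) {f : List (Finset ι) → ℝ → ℝ}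
    (hf : ∀ L, Integrable (f L)) :
    ∫ s, sumBlocks ℓ S (fun L => f L s) = sumBlocks ℓ S fun L => ∫ s, f L s := by
  induction ℓ generalizing S f with
  | zero =>
    simp only [sumBlocks]
    split_ifs
    · rfl
    · exact integral_zero _ _
  | succ ℓ ih =>
    simp only [sumBlocks]
    rw [integral_finsetSum _ fun B _ => integrable_sumBlocks ℓ (S \ B) fun L => hf (B :: L)]
    exact Finset.sum_congr rfl fun B _ => ih (S \ B) fun L => hf (B :: L)

theorem sumBlocks_mul_left (c : ℝ) (ℓ : ℕ) (S : Finset ι) (f : List (Finset ι) → ℝ) :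
    sumBlocks ℓ S (fun L => c * f L) = c * sumBlocks ℓ S f := by
  induction ℓ generalizing S f with
  | zero => simp only [sumBlocks, mul_ite, mul_zero]
  | succ ℓ ih => simp only [sumBlocks, Finset.mul_sum, ih]

/-- The sum of `x` over a block; the value at the empty block is chosen to be positive. -/
def blockWeight (x : ι → ℝ) (B : Finset ι) : ℝ := if B = ∅ then 1 else ∑ i ∈ B, x i

theorem blockWeight_pos {x : ι → ℝ} (hx : ∀ i, 0 < x i) (B : Finset ι) : 0 < blockWeight x B := by
  unfold blockWeight
  split_ifs with hB
  · exact one_pos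
  · exact Finset.sum_pos (fun i _ => hx i) (Finset.nonempty_iff_ne_empty.2 hB)

theorem blockWeight_of_nonempty (x : ι → ℝ) {B : Finset ι} (hB : B.Nonempty) :
    blockWeight x B = ∑ i ∈ B, x i :=
  if_neg hB.ne_empty

/-- The weight `-1` on `[0, ∞)` at every step of a path, whatever its ends `i` and `j`. -/
def negHalfLine {κ : Type*} (_i _j : κ) : ℝ → ℝ := halfLineWeight (-1)

theorem isUnitWeight_negHalfLine {κ : Type*} (i j : κ) : IsUnitWeight (negHalfLine i j) :=
  isUnitWeight_halfLineWeight _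

/-- The contribution of all sequences of at most `N` blocks with union `S` that follow an initial
block of total size `y`. -/
def blocksAfter (x : ι → ℝ) (N : ℕ) (y : ℝ) (S : Finset ι) (r : ℝ) : ℝ :=
  ∑ ℓ ∈ Finset.range (N + 1), sumBlocks ℓ S
    (headIntegral (blockWeight x) negHalfLine y (fun _ => halfLineWeight (-1)) · r)

theorem blocksAfter_sum (x : ι → ℝ) (N : ℕ) {B : Finset ι} (hB : B.Nonempty) (S : Finset ι)
    (r : ℝ) :
    blocksAfter x N (∑ i ∈ B, x i) S r = ∑ ℓ ∈ Finset.range (N + 1), sumBlocks ℓ S fun L =>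
      pathIntegral (blockWeight x) negHalfLine (B :: L) r := by
  simp_rw [pathIntegral_cons, blockWeight_of_nonempty x hB]
  rfl

theorem blocksAfter_empty (x : ι → ℝ) (N : ℕ) (y r : ℝ) :
    blocksAfter x N y ∅ r = airyKernel y r 0 := by
  rw [blocksAfter, Finset.sum_range_succ', Finset.sum_eq_zero, zero_add]
  · exact if_pos rfl
  · intro ℓ _
    rw [sumBlocks, Finset.powerset_empty, Finset.filter_singleton,
      if_neg Finset.not_nonempty_empty, Finset.sum_empty]

theorem blocksAfter_succ {x : ι → ℝ} (hx : ∀ i, 0 < x i) (N : ℕ) {y : ℝ} (hy : 0 < y)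
    {S : Finset ι} (hS : S.Nonempty) (r : ℝ) :
    blocksAfter x (N + 1) y S r = ∫ s, halfLineWeight (-1) s * (airyKernel y r s *
      ∑ B ∈ S.powerset with B.Nonempty, blocksAfter x N (∑ i ∈ B, x i) (S \ B) s) := by
  have hint (B : Finset ι) (L : List (Finset ι)) : Integrable fun s =>
      halfLineWeight (-1) s * (airyKernel y r s *
        pathIntegral (blockWeight x) negHalfLine (B :: L) s) :=
    integrable_mul_airyKernel_mul_pathIntegral (blockWeight_pos hx) isUnitWeight_negHalfLine
      (isUnitWeight_halfLineWeight _) hy B L r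
  calc blocksAfter x (N + 1) y S r
      = ∑ ℓ ∈ Finset.range (N + 1), ∑ B ∈ S.powerset with B.Nonempty, sumBlocks ℓ (S \ B) fun L =>
          ∫ s, halfLineWeight (-1) s * (airyKernel y r s *
            pathIntegral (blockWeight x) negHalfLine (B :: L) s) := by
        rw [blocksAfter, Finset.sum_range_succ']
        simp only [sumBlocks, if_neg hS.ne_empty, add_zero, headIntegral]
    _ = ∫ s, ∑ B ∈ S.powerset with B.Nonempty, ∑ ℓ ∈ Finset.range (N + 1),
          sumBlocks ℓ (S \ B) fun L => halfLineWeight (-1) s * (airyKernel y r s *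
            pathIntegral (blockWeight x) negHalfLine (B :: L) s) := by
        have hsum (B : Finset ι) (ℓ : ℕ) := integrable_sumBlocks ℓ (S \ B) (hint B)
        rw [integral_finsetSum _ fun B _ => integrable_finsetSum _ fun ℓ _ => hsum B ℓ,
          Finset.sum_comm]
        simp_rw [fun B => integral_finsetSum (Finset.range (N + 1)) fun ℓ _ => hsum B ℓ,
          fun B ℓ => integral_sumBlocks ℓ (S \ B) (hint B)]
    _ = _ := by
        refine integral_congr_ae (ae_of_all _ fun s => ?_)
        simp only [sumBlocks_mul_left, ← Finset.mul_sum]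
        exact congrArg _ (congrArg _ (Finset.sum_congr rfl fun B hB =>
          (blocksAfter_sum x N (Finset.mem_filter.1 hB).2 _ s).symm))

end SumBlocks

section MergeOrderings

theorem sum_insert_max {ι M : Type*} [LinearOrder ι]
    [∀ j : ι, DecidablePred fun B : Finset ι => ∀ b ∈ B, b < j] [AddCommMonoid M] (S : Finset ι)
    (f : Finset ι → M) :
    ∑ j ∈ S, ∑ B ∈ (S.erase j).powerset with ∀ b ∈ B, b < j, f (insert j B) =
      ∑ B ∈ S.powerset with B.Nonempty, f B := by
  simp_rw [Finset.sum_filter]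
  rw [← sum_powerset_sum_mem S fun j B => if ∀ b ∈ B, b < j then f (insert j B) else 0]
  refine Finset.sum_congr rfl fun B _ => ?_
  split_ifs with hB
  · rw [Finset.sum_eq_single (B.max' hB)]
    · rw [if_pos fun b hb => Finset.lt_max'_of_mem_erase_max' B hB hb,
        Finset.insert_erase (B.max'_mem hB)]
    · intro a ha hne
      refine if_neg fun hlt => ?_
      exact (B.le_max' a ha).not_gt (hlt _ (Finset.mem_erase.2 ⟨hne.symm, B.max'_mem hB⟩))
    · exact fun hmem => absurd (B.max'_mem hB) hmem
  · rw [Finset.not_nonempty_iff_eq_empty.1 hB, Finset.sum_empty]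

theorem sum_powerset_lt_eq_add_sum_insert_max {ι M : Type*} [LinearOrder ι]
    [∀ j : ι, DecidablePred fun B : Finset ι => ∀ b ∈ B, b < j] [DecidableLT ι] [AddCommMonoid M]
    (S : Finset ι) (i : ι) (f : Finset ι → M) :
    ∑ B ∈ S.powerset with ∀ b ∈ B, b < i, f B =
      f ∅ + ∑ j ∈ S with j < i, ∑ B ∈ (S.erase j).powerset with ∀ b ∈ B, b < j,
        f (insert j B) := by
  have hmax := sum_insert_max S fun B => if ∀ b ∈ B, b < i then f B else 0
  have hinner (j : ι) : (∑ B ∈ (S.erase j).powerset with ∀ b ∈ B, b < j,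
        if ∀ b ∈ insert j B, b < i then f (insert j B) else 0) =
      if j < i then ∑ B ∈ (S.erase j).powerset with ∀ b ∈ B, b < j, f (insert j B) else 0 := by
    split_ifs with hji
    · refine Finset.sum_congr rfl fun B hB => if_pos ?_
      rw [Finset.forall_mem_insert]
      exact ⟨hji, fun b hb => ((Finset.mem_filter.1 hB).2 b hb).trans hji⟩
    · exact Finset.sum_eq_zero fun B _ => if_neg fun h => hji (h j (Finset.mem_insert_self j B))
  rw [Finset.sum_filter (fun j => j < i), ← Finset.sum_congr rfl fun j _ => hinner j, hmax,
    Finset.sum_filter, Finset.sum_filter, ← Finset.add_sum_erase _ _ (Finset.empty_mem_powerset S),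
    ← Finset.sum_erase (a := ∅) S.powerset (if_neg Finset.not_nonempty_empty)]
  refine congrArg₂ _ (if_pos (by simp)) (Finset.sum_congr rfl fun B hB => ?_)
  rw [if_pos (Finset.nonempty_iff_ne_empty.2 (Finset.ne_of_mem_erase hB))]

variable {n : ℕ} {x : Fin n → ℝ}

theorem stepWeight_of_lt {i j : Fin n} (hij : i < j) : stepWeight i j = halfLineWeight (-1) := by
  have hneg : ((i : ℕ) : ℝ) - ((j : ℕ) : ℝ) < 0 := sub_neg.2 (by exact_mod_cast hij)
  rw [stepWeight, halfLineWeight_of_neg hneg, halfLineWeight_of_neg (by norm_num)]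

theorem stepWeight_of_gt {i j : Fin n} (hij : j < i) {s : ℝ} (hs : s ≠ 0) :
    stepWeight i j s = halfLineWeight (-1) s + 1 := by
  have hpos : 0 < ((i : ℕ) : ℝ) - ((j : ℕ) : ℝ) := sub_pos.2 (by exact_mod_cast hij)
  rw [stepWeight, halfLineWeight_of_pos hpos, halfLineWeight_of_neg (by norm_num)]
  rcases lt_or_gt_of_ne hs with h | h <;> simp [h.le, h.not_ge]

theorem headIntegral_cons_stepWeight (hx : ∀ i, 0 < x i) {y : ℝ} (hy : 0 < y)
    {i j : Fin n} (hij : i ≠ j) (l : List (Fin n)) (r : ℝ) :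
    headIntegral x stepWeight y (stepWeight i) (j :: l) r =
      (∫ s, halfLineWeight (-1) s * (airyKernel y r s * pathIntegral x stepWeight (j :: l) s)) +
        if j < i then headIntegral x stepWeight (y + x j) (stepWeight j) l r else 0 := by
  have hint {w : ℝ → ℝ} (hw : IsUnitWeight w) : Integrable fun s =>
      w s * (airyKernel y r s * pathIntegral x stepWeight (j :: l) s) :=
    integrable_mul_airyKernel_mul_pathIntegral hx isUnitWeight_stepWeight hw hy j l r
  rw [headIntegral]
  rcases lt_or_gt_of_ne hij with hlt | hgt
  · rw [if_neg hlt.not_gt, add_zero, stepWeight_of_lt hlt]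
  · have hone : Integrable fun s => airyKernel y r s * pathIntegral x stepWeight (j :: l) s := by
      simpa only [one_mul] using hint ⟨measurable_const (a := (1 : ℝ)), by simp⟩
    rw [if_pos hgt, ← integral_airyKernel_mul_pathIntegral hx isUnitWeight_stepWeight hy,
      ← integral_add (hint (isUnitWeight_halfLineWeight _)) hone]
    refine integral_congr_ae ?_
    filter_upwards [Measure.ae_ne volume (0 : ℝ)] with s hs
    rw [stepWeight_of_gt hgt hs]
    ring

theorem sum_headIntegral_stepWeight (hx : ∀ i, 0 < x i) {S : Finset (Fin n)} (hS : S.Nonempty)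
    {i : Fin n} (hi : i ∉ S) {y : ℝ} (hy : 0 < y) (r : ℝ) :
    ∑ l ∈ orderings S, headIntegral x stepWeight y (stepWeight i) l r =
      (∫ s, halfLineWeight (-1) s *
          (airyKernel y r s * ∑ l ∈ orderings S, pathIntegral x stepWeight l s)) +
        ∑ j ∈ S with j < i, ∑ l ∈ orderings (S.erase j),
          headIntegral x stepWeight (y + x j) (stepWeight j) l r := by
  have hint (j : Fin n) (l : List (Fin n)) : Integrable fun s =>
      halfLineWeight (-1) s * (airyKernel y r s * pathIntegral x stepWeight (j :: l) s) :=
    integrable_mul_airyKernel_mul_pathIntegral hx isUnitWeight_stepWeight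
      (isUnitWeight_halfLineWeight _) hy j l r
  simp only [sum_orderings_eq_sum_cons S, if_neg hS.ne_empty, zero_add, Finset.mul_sum]
  rw [integral_finsetSum _ fun j _ => integrable_finsetSum _ fun l _ => hint j l,
    Finset.sum_filter, ← Finset.sum_add_distrib]
  refine Finset.sum_congr rfl fun j hj => ?_
  rw [integral_finsetSum _ fun l _ => hint j l, Finset.sum_congr rfl fun l _ =>
    headIntegral_cons_stepWeight hx hy (ne_of_mem_of_not_mem hj hi).symm l r,
    Finset.sum_add_distrib]
  split_ifs <;> simp

theorem sum_pathIntegral_eq_sum_blocksAfter {S : Finset (Fin n)} (hS : S.Nonempty) {N : ℕ} {r : ℝ}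
    (hhead : ∀ j ∈ S,
      ∑ l ∈ orderings (S.erase j), headIntegral x stepWeight (x j) (stepWeight j) l r =
        ∑ B ∈ (S.erase j).powerset with ∀ b ∈ B, b < j,
          blocksAfter x N (x j + ∑ b ∈ B, x b) (S.erase j \ B) r) :
    ∑ l ∈ orderings S, pathIntegral x stepWeight l r =
      ∑ B ∈ S.powerset with B.Nonempty, blocksAfter x N (∑ b ∈ B, x b) (S \ B) r := by
  rw [sum_orderings_eq_sum_cons, if_neg hS.ne_empty, zero_add,
    ← sum_insert_max S fun B => blocksAfter x N (∑ b ∈ B, x b) (S \ B) r]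
  refine Finset.sum_congr rfl fun j hj => ?_
  simp_rw [pathIntegral_cons]
  rw [hhead j hj]
  refine Finset.sum_congr rfl fun B hB => ?_
  have hjB : j ∉ B := fun hmem => lt_irrefl j ((Finset.mem_filter.1 hB).2 j hmem)
  rw [Finset.sum_insert hjB, Finset.sdiff_insert, Finset.erase_sdiff_comm]

/-- Up to a null set, the weight of a descent is the weight of an ascent plus `1`. The `1` lets
the semigroup law merge the two steps, so each run of descents becomes a block. -/
theorem sum_headIntegral_eq_sum_blocksAfter (hx : ∀ i, 0 < x i) (S : Finset (Fin n)) :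
    ∀ N, S.card ≤ N → ∀ i ∉ S, ∀ y, 0 < y → ∀ r,
      ∑ l ∈ orderings S, headIntegral x stepWeight y (stepWeight i) l r =
        ∑ B ∈ S.powerset with ∀ b ∈ B, b < i, blocksAfter x N (y + ∑ b ∈ B, x b) (S \ B) r := by
  induction S using Finset.strongInduction with
  | H S ih =>
    intro N hN i hi y hy r
    rcases Finset.eq_empty_or_nonempty S with rfl | hS
    · simp [orderings_empty, headIntegral, Finset.sum_filter, blocksAfter_empty]
    obtain ⟨M, rfl⟩ : ∃ M, N = M + 1 :=
      Nat.exists_eq_succ_of_ne_zero (hS.card_pos.trans_le hN).ne'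
    have hcard : ∀ j ∈ S, (S.erase j).card ≤ M := fun j hj => by
      rw [Finset.card_erase_of_mem hj]; omega
    have hpath := fun s => sum_pathIntegral_eq_sum_blocksAfter (x := x) hS fun j hj =>
      ih _ (Finset.erase_ssubset hj) M (hcard j hj) j (Finset.notMem_erase j S) _ (hx j) s
    rw [sum_headIntegral_stepWeight hx hS hi hy, sum_powerset_lt_eq_add_sum_insert_max]
    simp_rw [hpath, ← blocksAfter_succ hx M hy hS]
    simp only [Finset.sum_empty, add_zero, Finset.sdiff_empty]
    refine congrArg _ (Finset.sum_congr rfl fun j hj => ?_)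
    have hjS := Finset.mem_of_mem_filter j hj
    rw [ih _ (Finset.erase_ssubset hjS) (M + 1) ((hcard j hjS).trans M.le_succ) j
      (Finset.notMem_erase j S) _ (add_pos hy (hx j))]
    refine Finset.sum_congr rfl fun B hB => ?_
    have hjB : j ∉ B := fun hmem => lt_irrefl j ((Finset.mem_filter.1 hB).2 j hmem)
    rw [Finset.sum_insert hjB, Finset.sdiff_insert, Finset.erase_sdiff_comm, add_assoc]

theorem sum_pathIntegral_orderings (hx : ∀ i, 0 < x i) (S : Finset (Fin n)) (r : ℝ) :
    ∑ l ∈ orderings S, pathIntegral x stepWeight l r =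
      ∑ ℓ ∈ Finset.range S.card, sumBlocks (ℓ + 1) S fun L =>
        pathIntegral (blockWeight x) negHalfLine L r := by
  rcases Finset.eq_empty_or_nonempty S with rfl | hS
  · simp [orderings_empty, pathIntegral]
  obtain ⟨N, hN⟩ := Nat.exists_eq_succ_of_ne_zero hS.card_ne_zero
  rw [sum_pathIntegral_eq_sum_blocksAfter hS fun j hj => sum_headIntegral_eq_sum_blocksAfter hx _
    N (by rw [Finset.card_erase_of_mem hj, hN, Nat.succ_sub_one]) j (Finset.notMem_erase j S) _
    (hx j) r, hN]
  simp only [sumBlocks]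
  rw [Finset.sum_comm]
  exact Finset.sum_congr rfl fun B hB => blocksAfter_sum x N (Finset.mem_filter.1 hB).2 _ r

end MergeOrderings

/-! ### Cyclic integrals -/

section AiryGraph

variable {ι κ : Type*} [Fintype ι] [Fintype κ] {y : ι → ℝ} {δ : κ → ℝ}

theorem prod_sqrt_mul_self (hy : ∀ j, 0 < y j) :
    (∏ j, Real.sqrt (2 * Real.pi * y j)) * ∏ j, Real.sqrt (2 * Real.pi * y j) =
      (2 * Real.pi) ^ Fintype.card ι * ∏ j, y j := by
  rw [← Finset.prod_mul_distrib, Fintype.card, ← Finset.prod_const, ← Finset.prod_mul_distrib]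
  exact Finset.prod_congr rfl fun j _ =>
    Real.mul_self_sqrt (mul_nonneg Real.two_pi_pos.le (hy j).le)

theorem prod_sqrt_ne_zero (hy : ∀ j, 0 < y j) : ∏ j, Real.sqrt (2 * Real.pi * y j) ≠ 0 :=
  (Finset.prod_pos fun j _ => Real.sqrt_pos.2 (mul_pos Real.two_pi_pos (hy j))).ne'

theorem exp_mul_exp_eq_airyKernel {t : ℝ} (ht : 0 < t) (u v : ℝ) :
    Real.exp (-((u + v) * t / 2)) * Real.exp (-t * ((v - u) / t) ^ 2 / 2) =
      Real.exp (-(t ^ 3 / 24)) * (Real.sqrt (2 * Real.pi * t) * airyKernel t u v) := by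
  rw [sqrt_mul_airyKernel ht, ← Real.exp_add, ← Real.exp_add]
  congr 1
  field_simp
  ring

theorem halfLineWeight_of_neg_eq {t : ℝ} (ht : t < 0) : halfLineWeight t = halfLineWeight (-1) := by
  rw [halfLineWeight_of_neg ht, halfLineWeight_of_neg neg_one_lt_zero]

/-- The normalizing constant relating `∫ gaussianFractions y 0 M δ` to Airy heat kernels. -/
def airyConst (y : ι → ℝ) : ℝ :=
  Real.exp ((∑ j, y j ^ 3) / 24) / ((2 * Real.pi) ^ Fintype.card ι * ∏ j, y j)

theorem airyConst_comp_perm (y : ι → ℝ) (σ : Equiv.Perm ι) : airyConst (y ∘ σ) = airyConst y := by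
  simp only [airyConst, Function.comp_apply, Equiv.sum_comp σ fun j => y j ^ 3,
    Equiv.prod_comp σ y]

/-- When the increments along a graph are the linear forms dual to `M` and the damping `δ` collects
the linear potential, the Gaussian integral is an integral of Airy heat kernels over an orthant. -/
theorem airyConst_mul_integral_gaussianFractions (hy : ∀ j, 0 < y j) (hδ : ∀ q, δ q < 0)
    {M : Matrix κ ι ℝ} {u v : (κ → ℝ) → ι → ℝ} (hM : ∀ s j, (s ᵥ* M) j = (v s j - u s j) / y j)
    (huv : ∀ s, s ⬝ᵥ δ = -∑ j, (u s j + v s j) * y j / 2) :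
    airyConst y * ∫ f, gaussianFractions y 0 M δ f =
      (∫ s, (∏ q, halfLineWeight (-1) (s q)) * ∏ j, airyKernel (y j) (u s j) (v s j) : ℝ) := by
  have hkernel (s : κ → ℝ) : (∏ q, Real.exp (s q * δ q)) *
        ∏ j, Real.exp (-y j * (s ᵥ* M) j ^ 2 / 2) =
      Real.exp (-((∑ j, y j ^ 3) / 24)) * ((∏ j, Real.sqrt (2 * Real.pi * y j)) *
        ∏ j, airyKernel (y j) (u s j) (v s j)) := by
    simp_rw [hM]
    rw [← Real.exp_sum, ← dotProduct, huv, ← Finset.sum_neg_distrib, Real.exp_sum,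
      ← Finset.prod_mul_distrib,
      Finset.prod_congr rfl fun j _ => exp_mul_exp_eq_airyKernel (hy j) _ _,
      Finset.prod_mul_distrib, Finset.prod_mul_distrib, ← Real.exp_sum, Finset.sum_neg_distrib,
      ← Finset.sum_div]
  have hsqrt := prod_sqrt_ne_zero hy
  rw [integral_gaussianFractions 0 M hy fun q => (hδ q).ne, ← Complex.ofReal_mul, airyConst,
    ← prod_sqrt_mul_self hy, ← integral_const_mul, ← integral_const_mul]
  congr 2
  funext s
  simp_rw [zero_add]
  rw [Finset.prod_mul_distrib, mul_assoc (∏ q, _), hkernel, Real.exp_neg,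
    Finset.prod_congr rfl fun q _ => congrFun (halfLineWeight_of_neg_eq (hδ q)) (s q)]
  field_simp

end AiryGraph

section Cyclic

variable {ℓ : ℕ} {y : Fin ℓ → ℝ}

/-- The factor `i (f_j/y_j - f_{j+1}/y_{j+1}) - (y_j + y_{j+1})/2` of the cyclic integrand. -/
def cyclicFactor (y f : Fin ℓ → ℝ) (j : Fin ℓ) : ℂ :=
  Complex.I * ((f j / y j - f (finRotate ℓ j) / y (finRotate ℓ j) : ℝ) : ℂ) -
    (((y j + y (finRotate ℓ j)) / 2 : ℝ) : ℂ)

theorem cyclicIntegrand_eq (y f : Fin ℓ → ℝ) :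
    cyclicIntegrand y f =
      ((∏ j, y j : ℝ) : ℂ)⁻¹ * (gaussianWeight y f * ∏ j, (cyclicFactor y f j)⁻¹) := by
  rw [cyclicIntegrand, Finset.prod_div_distrib, Complex.ofReal_div, Finset.prod_inv_distrib]
  simp only [cyclicFactor, gaussianWeight]
  ring

theorem cyclicIntegral_eq_airyConst_mul (y : Fin ℓ → ℝ) :
    cyclicIntegral y =
      airyConst y * ∫ f, (gaussianWeight y f : ℂ) * ∏ j, (cyclicFactor y f j)⁻¹ := by
  simp_rw [cyclicIntegral, cyclicIntegrand_eq]
  rw [integral_const_mul, ← mul_assoc, ← Complex.ofReal_inv, ← Complex.ofReal_mul, airyConst,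
    Fintype.card_fin, ← div_eq_mul_inv, div_div]

/-- The matrix of the linear forms `f_q / y_q - f_{q+1} / y_{q+1}`, with cyclic indices. -/
def cyclicMatrix (y : Fin ℓ → ℝ) : Matrix (Fin ℓ) (Fin ℓ) ℝ := fun q =>
  Pi.single q (y q)⁻¹ - Pi.single (finRotate ℓ q) (y (finRotate ℓ q))⁻¹

theorem cyclicMatrix_mulVec (y f : Fin ℓ → ℝ) (q : Fin ℓ) :
    (cyclicMatrix y *ᵥ f) q = f q / y q - f (finRotate ℓ q) / y (finRotate ℓ q) := by
  change (Pi.single _ _ - Pi.single _ _) ⬝ᵥ f = _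
  rw [sub_dotProduct, single_dotProduct, single_dotProduct, div_eq_inv_mul, div_eq_inv_mul]

theorem vecMul_cyclicMatrix (y s : Fin ℓ → ℝ) (j : Fin ℓ) :
    (s ᵥ* cyclicMatrix y) j = (s j - s ((finRotate ℓ).symm j)) / y j := by
  simp only [cyclicMatrix, Matrix.vecMul, dotProduct, Pi.sub_apply, mul_sub,
    Finset.sum_sub_distrib, Pi.single_apply, mul_ite, mul_zero, ← Equiv.symm_apply_eq,
    Finset.sum_ite_eq, Finset.mem_univ, if_true, Equiv.apply_symm_apply, div_eq_mul_inv, sub_mul]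

/-- The real parts of the cyclic factors. -/
def cyclicDamping (y : Fin ℓ → ℝ) (q : Fin ℓ) : ℝ := -((y q + y (finRotate ℓ q)) / 2)

theorem cyclicDamping_neg (hy : ∀ j, 0 < y j) (q : Fin ℓ) : cyclicDamping y q < 0 :=
  neg_neg_of_pos (half_pos (add_pos (hy _) (hy _)))

theorem dotProduct_cyclicDamping (y s : Fin ℓ → ℝ) :
    s ⬝ᵥ cyclicDamping y = -∑ j, (s ((finRotate ℓ).symm j) + s j) * y j / 2 := by
  have hrotate : ∑ j, s ((finRotate ℓ).symm j) * y j = ∑ q, s q * y (finRotate ℓ q) := by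
    rw [← Equiv.sum_comp (finRotate ℓ)]
    simp only [Equiv.symm_apply_apply]
  simp only [dotProduct, cyclicDamping, ← Finset.sum_div, add_mul, mul_neg, mul_div_assoc', mul_add,
    Finset.sum_add_distrib, Finset.sum_neg_distrib, hrotate, add_comm]

theorem cyclicFactor_eq (y f : Fin ℓ → ℝ) (q : Fin ℓ) :
    cyclicFactor y f q = Complex.I * ((cyclicMatrix y *ᵥ f) q : ℝ) + cyclicDamping y q := by
  rw [cyclicFactor, cyclicMatrix_mulVec, cyclicDamping, Complex.ofReal_neg, sub_eq_add_neg]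

theorem cyclicFactor_ne_zero (hy : ∀ j, 0 < y j) (f : Fin ℓ → ℝ) (j : Fin ℓ) :
    cyclicFactor y f j ≠ 0 := fun hzero => by
  have hre := congrArg Complex.re hzero
  rw [cyclicFactor_eq] at hre
  simp only [Complex.add_re, Complex.I_mul_re, Complex.ofReal_im, Complex.ofReal_re, neg_zero,
    zero_add, Complex.zero_re] at hre
  exact (cyclicDamping_neg hy j).ne hre

theorem gaussianFractions_cyclicMatrix (y f : Fin ℓ → ℝ) :
    gaussianFractions y 0 (cyclicMatrix y) (cyclicDamping y) f =
      gaussianWeight y f * ∏ j, (cyclicFactor y f j)⁻¹ := by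
  simp only [gaussianFractions, zero_dotProduct, Complex.ofReal_zero, mul_zero, Complex.exp_zero,
    mul_one, cyclicFactor_eq]

theorem integrable_cyclicIntegrand (hy : ∀ j, 0 < y j) : Integrable (cyclicIntegrand y) := by
  simp_rw [funext (cyclicIntegrand_eq y), ← gaussianFractions_cyclicMatrix]
  exact (integrable_gaussianFractions 0 _ hy fun q => (cyclicDamping_neg hy q).ne).const_mul _

theorem prod_halfLineWeight_neg_one (s : Fin ℓ → ℝ) :
    ∏ q, halfLineWeight (-1) (s q) = (Set.Ici (0 : Fin ℓ → ℝ)).indicator (fun _ => (-1) ^ ℓ) s := by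
  rw [halfLineWeight_of_neg neg_one_lt_zero]
  by_cases hs : 0 ≤ s
  · rw [Set.indicator_of_mem (Set.mem_Ici.2 hs), Finset.prod_congr rfl fun q _ =>
      Set.indicator_of_mem (show s q ∈ Set.Ici 0 from hs q) fun _ => (-1 : ℝ), Finset.prod_const,
      Finset.card_fin]
  · obtain ⟨q, hq⟩ := not_forall.1 hs
    rw [Set.indicator_of_notMem (show s ∉ Set.Ici 0 from hs),
      Finset.prod_eq_zero (Finset.mem_univ q)
        (Set.indicator_of_notMem (show s q ∉ Set.Ici 0 from hq) _)]

theorem cyclicIntegral_eq_integral_airyKernel (hy : ∀ j, 0 < y j) :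
    cyclicIntegral y =
      ((-1) ^ ℓ * ∫ s in Set.Ici (0 : Fin ℓ → ℝ),
        ∏ j, airyKernel (y j) (s j) (s (finRotate ℓ j)) : ℝ) := by
  have hrotate : ∫ s : Fin ℓ → ℝ, (∏ q, halfLineWeight (-1) (s q)) *
        ∏ j, airyKernel (y j) (s ((finRotate ℓ).symm j)) (s j) =
      (-1) ^ ℓ * ∫ s in Set.Ici (0 : Fin ℓ → ℝ),
        ∏ j, airyKernel (y j) (s j) (s (finRotate ℓ j)) := by
    rw [← integral_comp_perm (finRotate ℓ), ← integral_indicator measurableSet_Ici,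
      ← integral_const_mul]
    congr 1
    funext s
    simp only [Function.comp_apply, Equiv.apply_symm_apply]
    rw [Equiv.prod_comp (finRotate ℓ) fun q => halfLineWeight (-1) (s q),
      prod_halfLineWeight_neg_one]
    by_cases hs : s ∈ Set.Ici 0 <;> simp [hs]
  simp_rw [cyclicIntegral_eq_airyConst_mul, ← gaussianFractions_cyclicMatrix]
  rw [airyConst_mul_integral_gaussianFractions hy (cyclicDamping_neg hy) (vecMul_cyclicMatrix y)
    (dotProduct_cyclicDamping y), hrotate]

theorem integrableOn_okounkovIntegrand (hy : ∀ j, 0 < y j) :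
    IntegrableOn (okounkovIntegrand y) {s | ∀ j, 0 ≤ s j} := by
  have hdecay : Integrable fun s : Fin ℓ → ℝ =>
      ∏ j, (Set.Ici (0 : ℝ)).indicator (fun t => Real.exp (-(y j / 2) * t)) (s j) := by
    refine Integrable.fintype_prod
      (f := fun j => (Set.Ici (0 : ℝ)).indicator fun t => Real.exp (-(y j / 2) * t)) fun j => ?_
    rw [integrable_indicator_iff measurableSet_Ici, integrableOn_Ici_iff_integrableOn_Ioi]
    exact exp_neg_integrableOn_Ioi 0 (half_pos (hy j))
  refine hdecay.integrableOn.mono' (Measurable.aestronglyMeasurable ?_)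
    ((ae_restrict_iff' (measurableSet_Ici (a := (0 : Fin ℓ → ℝ)))).2 (ae_of_all _ fun s hs => ?_))
  · unfold okounkovIntegrand
    fun_prop
  · rw [Finset.prod_congr rfl fun j _ =>
        Set.indicator_of_mem (show s j ∈ Set.Ici (0 : ℝ) from hs j) _,
      ← Real.exp_sum, okounkovIntegrand, Real.norm_of_nonneg (Real.exp_pos _).le,
      Real.exp_le_exp, ← Finset.sum_neg_distrib]
    refine Finset.sum_le_sum fun j _ => ?_
    have hsq : 0 ≤ (s j - s (finRotate ℓ j)) ^ 2 / (4 * y j) :=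
      div_nonneg (sq_nonneg _) (mul_nonneg zero_le_four (hy j).le)
    have hnext : 0 ≤ s (finRotate ℓ j) * y j := mul_nonneg (hs _) (hy j).le
    linarith

theorem prod_airyKernel_rotate {t : ℝ} (ht : 0 < t) (ht3 : t ^ 3 = 2) (hy : ∀ j, 0 < y j)
    (s : Fin ℓ → ℝ) :
    (∏ j, Real.sqrt (2 * Real.pi * y j)) * ∏ j, airyKernel (y j) (s j) (s (finRotate ℓ j)) =
      Real.exp ((∑ j, y j ^ 3) / 24) * okounkovIntegrand (fun j => y j / t) (t • s) := by
  rw [← Finset.prod_mul_distrib, Finset.prod_congr rfl fun j _ => sqrt_mul_airyKernel (hy j) _ _,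
    ← Real.exp_sum, Finset.sum_add_distrib, Real.exp_add, ← Finset.sum_div, okounkovIntegrand,
    ← Finset.sum_neg_distrib]
  congr 3
  refine funext fun j => ?_
  have hj := (hy j).ne'
  simp only [Pi.smul_apply, smul_eq_mul]
  have hcube : (t * s j - t * s (finRotate ℓ j)) ^ 2 / (4 * (y j / t)) =
      t ^ 3 * ((s j - s (finRotate ℓ j)) ^ 2 / (4 * y j)) := by
    field_simp
  rw [hcube, ht3]
  field_simp
  ring

theorem prod_sqrt_four_pi_mul_div {t : ℝ} (ht : 0 < t) (ht3 : t ^ 3 = 2) (y : Fin ℓ → ℝ) :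
    ∏ j, Real.sqrt (4 * Real.pi * (y j / t)) = t ^ ℓ * ∏ j, Real.sqrt (2 * Real.pi * y j) := by
  rw [show t ^ ℓ = ∏ _j : Fin ℓ, t by simp, ← Finset.prod_mul_distrib]
  refine Finset.prod_congr rfl fun j _ => ?_
  have hsq : 4 * Real.pi * (y j / t) = t ^ 2 * (2 * Real.pi * y j) := by
    field_simp
    linear_combination -2 * y j * ht3
  rw [hsq, Real.sqrt_mul (sq_nonneg t), Real.sqrt_sq ht.le]

theorem smul_Ici_zero {t : ℝ} (ht : 0 < t) :
    t • Set.Ici (0 : Fin ℓ → ℝ) = Set.Ici 0 := by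
  ext s
  rw [Set.mem_smul_set_iff_inv_smul_mem₀ ht.ne', Set.mem_Ici, Set.mem_Ici,
    le_inv_smul_iff_of_pos ht, smul_zero]

theorem okounkovE_div_eq_integral_airyKernel {t : ℝ} (ht : 0 < t) (ht3 : t ^ 3 = 2)
    (hy : ∀ j, 0 < y j) :
    okounkovE (fun j => y j / t) =
      ∫ s in Set.Ici (0 : Fin ℓ → ℝ), ∏ j, airyKernel (y j) (s j) (s (finRotate ℓ j)) := by
  have hsqrt := prod_sqrt_ne_zero hy
  have hcube : (∑ j, (y j / t) ^ 3) / 12 = (∑ j, y j ^ 3) / 24 := by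
    simp_rw [div_pow, ht3, ← Finset.sum_div]
    ring
  have hscale := Measure.setIntegral_comp_smul_of_pos volume
    (okounkovIntegrand fun j => y j / t) (Set.Ici 0) ht
  rw [smul_Ici_zero ht, Module.finrank_fin_fun, smul_eq_mul, eq_inv_mul_iff_mul_eq₀ (by positivity)]
    at hscale
  refine mul_left_cancel₀ hsqrt ?_
  rw [← integral_const_mul]
  simp_rw [prod_airyKernel_rotate ht ht3 hy]
  rw [integral_const_mul, okounkovE, hcube, prod_sqrt_four_pi_mul_div ht ht3]
  change _ * (_ * ∫ s in Set.Ici 0, _) = _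
  rw [← hscale]
  field_simp

theorem cyclicIntegral_eq_okounkovE (hy : ∀ j, 0 < y j) :
    cyclicIntegral y = (-1) ^ ℓ * (okounkovE (fun j => y j / (2 : ℝ) ^ (1 / 3 : ℝ)) : ℂ) := by
  have hcube : ((2 : ℝ) ^ (1 / 3 : ℝ)) ^ 3 = 2 := by
    rw [← Real.rpow_natCast, ← Real.rpow_mul zero_le_two]
    norm_num
  rw [okounkovE_div_eq_integral_airyKernel (Real.rpow_pos_of_pos two_pos _) hcube hy,
    cyclicIntegral_eq_integral_airyKernel hy]
  push_cast
  rfl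

end Cyclic

/-! ### Cutting cyclic integrals open -/

section CutOpen

variable {k : ℕ} {y : Fin (k + 1) → ℝ}

/-- The integral over `s ∈ [0, ∞)^k` of the product of the kernels along the path
`0, s_1, …, s_k, 0`, with the sign `(-1)^k`. -/
def linearIntegral (y : Fin (k + 1) → ℝ) : ℝ :=
  ∫ s, pathIntegrand y negHalfLine id 0 s

/-- The cyclic integrand with its last factor removed: the cycle cut open at position `k`. -/
def openedIntegrand (y f : Fin (k + 1) → ℝ) : ℂ :=
  gaussianWeight y f * ∏ q : Fin k, (cyclicFactor y f q.castSucc)⁻¹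

theorem cyclicMatrix_castSucc (y : Fin (k + 1) → ℝ) (q : Fin k) :
    cyclicMatrix y q.castSucc = chainMatrix y q := by
  rw [cyclicMatrix, chainMatrix, finRotate_apply, Fin.coeSucc_eq_succ]

theorem gaussianFractions_chainMatrix (y f : Fin (k + 1) → ℝ) :
    gaussianFractions y 0 (chainMatrix y) (cyclicDamping y ∘ Fin.castSucc) f =
      openedIntegrand y f := by
  simp only [gaussianFractions, zero_dotProduct, Complex.ofReal_zero, mul_zero, Complex.exp_zero,
    mul_one, openedIntegrand, cyclicFactor_eq, Matrix.mulVec, cyclicMatrix_castSucc,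
    Function.comp_apply]

theorem integrable_openedIntegrand (hy : ∀ j, 0 < y j) : Integrable (openedIntegrand y) :=
  funext (gaussianFractions_chainMatrix y) ▸
    integrable_gaussianFractions 0 _ hy fun q => (cyclicDamping_neg hy q.castSucc).ne

theorem dotProduct_cyclicDamping_castSucc (y : Fin (k + 1) → ℝ) (s : Fin k → ℝ) :
    s ⬝ᵥ (cyclicDamping y ∘ Fin.castSucc) =
      -∑ j, ((Fin.cons 0 s : Fin (k + 1) → ℝ) j + (Fin.snoc s 0 : Fin (k + 1) → ℝ) j) *
        y j / 2 := by
  have hcons : ∑ j, (Fin.cons 0 s : Fin (k + 1) → ℝ) j * y j = ∑ q, s q * y q.succ := by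
    simp only [Fin.sum_univ_succ, Fin.cons_zero, Fin.cons_succ, zero_mul, zero_add]
  have hsnoc : ∑ j, (Fin.snoc s 0 : Fin (k + 1) → ℝ) j * y j = ∑ q, s q * y q.castSucc := by
    simp only [Fin.sum_univ_castSucc, Fin.snoc_castSucc, Fin.snoc_last, zero_mul, add_zero]
  simp only [← Finset.sum_div, add_mul, Finset.sum_add_distrib, hcons, hsnoc, dotProduct,
    Function.comp_apply, cyclicDamping, finRotate_apply, Fin.coeSucc_eq_succ, mul_neg,
    mul_div_assoc', mul_add, Finset.sum_neg_distrib, add_comm]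

theorem airyConst_mul_integral_openedIntegrand (hy : ∀ j, 0 < y j) :
    airyConst y * ∫ f, openedIntegrand y f = linearIntegral y := by
  simp_rw [← gaussianFractions_chainMatrix]
  rw [airyConst_mul_integral_gaussianFractions (δ := cyclicDamping y ∘ Fin.castSucc)
    (u := fun s => (Fin.cons 0 s : Fin (k + 1) → ℝ))
    (v := fun s => (Fin.snoc s 0 : Fin (k + 1) → ℝ)) hy (fun q => cyclicDamping_neg hy q.castSucc)
    (fun s j => by rw [vecMul_chainMatrix, loopIncrement]) (dotProduct_cyclicDamping_castSucc y)]
  simp only [linearIntegral, pathIntegrand, negHalfLine, id_eq]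

theorem cyclicFactor_add (y f : Fin (k + 1) → ℝ) (c j : Fin (k + 1)) :
    cyclicFactor y f (j + c) =
      cyclicFactor (y ∘ Equiv.addRight c) (f ∘ Equiv.addRight c) j := by
  simp only [cyclicFactor, finRotate_apply, Function.comp_apply, Equiv.coe_addRight,
    add_right_comm]

theorem sum_cyclicFactor (y f : Fin (k + 1) → ℝ) :
    ∑ j, cyclicFactor y f j = -((∑ j, y j : ℝ) : ℂ) := by
  simp only [cyclicFactor]
  rw [Finset.sum_sub_distrib, ← Finset.mul_sum, ← Complex.ofReal_sum, ← Complex.ofReal_sum,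
    Finset.sum_sub_distrib, Equiv.sum_comp (finRotate (k + 1)) fun j => f j / y j, sub_self,
    ← Finset.sum_div, Finset.sum_add_distrib, Equiv.sum_comp (finRotate (k + 1)) y,
    add_self_div_two, Complex.ofReal_zero, mul_zero, zero_sub]

theorem cyclicFactor_mul_prod_inv (hy : ∀ j, 0 < y j) (f : Fin (k + 1) → ℝ) (c : Fin (k + 1)) :
    cyclicFactor y f (Fin.last k + c) * (gaussianWeight y f * ∏ j, (cyclicFactor y f j)⁻¹) =
      openedIntegrand (y ∘ Equiv.addRight c) (f ∘ Equiv.addRight c) := by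
  have hlast : cyclicFactor y f (Fin.last k + c) ≠ 0 := cyclicFactor_ne_zero hy f _
  rw [openedIntegrand, gaussianWeight_comp_perm, ← Equiv.prod_comp (Equiv.addRight c),
    Fin.prod_univ_castSucc]
  simp only [← cyclicFactor_add]
  simp only [Equiv.coe_addRight]
  field_simp

/-- The differences telescope around the cycle, so the cyclic factors add up to the constant
`-∑ y_j`; multiplying by it removes one factor at a time. -/
theorem neg_sum_mul_prod_cyclicFactor (hy : ∀ j, 0 < y j) (f : Fin (k + 1) → ℝ) :
    -((∑ j, y j : ℝ) : ℂ) * (gaussianWeight y f * ∏ j, (cyclicFactor y f j)⁻¹) =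
      ∑ c, openedIntegrand (y ∘ Equiv.addRight c) (f ∘ Equiv.addRight c) := by
  rw [← sum_cyclicFactor y f, ← Equiv.sum_comp (Equiv.addLeft (Fin.last k)), Finset.sum_mul]
  exact Finset.sum_congr rfl fun c _ => cyclicFactor_mul_prod_inv hy f c

theorem neg_sum_mul_cyclicIntegral (hy : ∀ j, 0 < y j) :
    -((∑ j, y j : ℝ) : ℂ) * cyclicIntegral y =
      (∑ c : Fin (k + 1), linearIntegral (y ∘ Equiv.addRight c) : ℝ) := by
  rw [cyclicIntegral_eq_airyConst_mul, mul_left_comm, ← integral_const_mul]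
  simp_rw [neg_sum_mul_prod_cyclicFactor hy]
  rw [integral_finsetSum _ fun c _ => integrable_comp_perm (Equiv.addRight c)
    (integrable_openedIntegrand (y := y ∘ Equiv.addRight c) fun j => hy (j + c)), Finset.mul_sum,
    Complex.ofReal_sum]
  refine Finset.sum_congr rfl fun c _ => ?_
  rw [integral_comp_perm, ← airyConst_comp_perm y (Equiv.addRight c)]
  exact airyConst_mul_integral_openedIntegrand fun j => hy (j + c)

theorem neg_cyclicIntegral_eq (hy : ∀ j, 0 < y j) :
    -cyclicIntegral y =
      ((∑ j, y j)⁻¹ * ∑ c : Fin (k + 1), linearIntegral (y ∘ Equiv.addRight c) : ℝ) := by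
  have hsum : ((∑ j, y j : ℝ) : ℂ) ≠ 0 := by
    exact_mod_cast (Finset.sum_pos (fun j _ => hy j) Finset.univ_nonempty).ne'
  rw [Complex.ofReal_mul, ← neg_sum_mul_cyclicIntegral hy, Complex.ofReal_inv, neg_mul, mul_neg,
    inv_mul_cancel_left₀ hsum]

end CutOpen

/-! ### Ordered and cyclically ordered partitions -/

section OrderedPartition

variable {α : Type*}

/-- The sets `I_1, …, I_ℓ` form an ordered partition of `S` into nonempty blocks. -/
def IsOrderedPartition {ℓ : ℕ} (S : Finset α) (I : Fin ℓ → Finset α) : Prop :=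
  (∀ j, (I j).Nonempty) ∧ (∀ j k, j ≠ k → Disjoint (I j) (I k)) ∧ ∀ i, i ∈ S ↔ ∃ j, i ∈ I j

theorem isOrderedPartition_fin_zero {S : Finset α} {I : Fin 0 → Finset α} :
    IsOrderedPartition S I ↔ S = ∅ := by
  simp only [IsOrderedPartition, IsEmpty.forall_iff, IsEmpty.exists_iff, true_and, iff_false,
    Finset.eq_empty_iff_forall_notMem]

variable [DecidableEq α]

theorem isOrderedPartition_cons {ℓ : ℕ} {S B : Finset α} {I : Fin ℓ → Finset α} :
    IsOrderedPartition S (Fin.cons B I : Fin (ℓ + 1) → Finset α) ↔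
      B.Nonempty ∧ B ⊆ S ∧ IsOrderedPartition (S \ B) I := by
  simp only [IsOrderedPartition, Fin.forall_fin_succ, Fin.exists_fin_succ, Fin.cons_zero,
    Fin.cons_succ, Finset.mem_sdiff]
  constructor
  · rintro ⟨⟨hB, hI⟩, ⟨⟨-, hBI⟩, hII⟩, hS⟩
    refine ⟨hB, fun i hi => (hS i).2 (Or.inl hi), hI,
      fun j k hjk => (hII j).2 k fun h => hjk (Fin.succ_injective _ h), fun i => ?_⟩
    refine ⟨fun ⟨hi, hiB⟩ => ((hS i).1 hi).resolve_left hiB, fun ⟨j, hj⟩ => ?_⟩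
    exact ⟨(hS i).2 (Or.inr ⟨j, hj⟩), Finset.disjoint_right.1 (hBI j (Fin.succ_ne_zero j).symm) hj⟩
  · rintro ⟨hB, hBS, hI, hII, hS⟩
    have hBI (j : Fin ℓ) : Disjoint B (I j) :=
      Finset.disjoint_right.2 fun i hi => ((hS i).2 ⟨j, hi⟩).2
    refine ⟨⟨hB, hI⟩, ⟨⟨fun h => absurd rfl h, fun j _ => hBI j⟩,
      fun j => ⟨fun _ => (hBI j).symm, fun k hjk => hII j k fun h => hjk (h ▸ rfl)⟩⟩, fun i => ?_⟩
    rw [← hS i]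
    by_cases hi : i ∈ B
    · simp only [hi, hBS hi, true_or]
    · simp only [hi, not_false_eq_true, and_true, false_or]

open Classical in
theorem sumBlocks_eq_sum [Fintype α] (ℓ : ℕ) (S : Finset α) (f : List (Finset α) → ℝ) :
    sumBlocks ℓ S f =
      ∑ I : Fin ℓ → Finset α with IsOrderedPartition S I, f (List.ofFn I) := by
  induction ℓ generalizing S f with
  | zero =>
    simp only [sumBlocks, Finset.sum_filter, Fintype.sum_unique, isOrderedPartition_fin_zero,
      List.ofFn_zero]
  | succ ℓ ih =>
    have hblock : S.powerset.filter Finset.Nonempty =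
        ({B | B.Nonempty ∧ B ⊆ S} : Finset (Finset α)) := by
      ext B
      simp only [Finset.mem_filter, Finset.mem_powerset, Finset.mem_univ, true_and, and_comm]
    rw [sumBlocks, hblock, Finset.sum_filter, Finset.sum_filter,
      ← Equiv.sum_comp (Fin.consEquiv fun _ => Finset α), Fintype.sum_prod_type]
    refine Finset.sum_congr rfl fun B _ => ?_
    have hcons (I : Fin ℓ → Finset α) : Fin.consEquiv (fun _ => Finset α) (B, I) =
      (Fin.cons B I : Fin (ℓ + 1) → Finset α) := rfl
    simp only [hcons, isOrderedPartition_cons, List.ofFn_cons, ← and_assoc]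
    split_ifs with hB
    · simp only [ih, Finset.sum_filter, hB, true_and]
    · simp only [hB, false_and, if_false, Finset.sum_const_zero]

end OrderedPartition

section Rotation

variable {n k ℓ : ℕ}

theorem sumBlocks_univ (ℓ : ℕ) (f : List (Finset (Fin n)) → ℝ) :
    sumBlocks ℓ Finset.univ f = ∑ I : OrderedSetPartition n ℓ, f (List.ofFn I.1) := by
  classical
  rw [sumBlocks_eq_sum]
  refine Finset.sum_subtype _ (fun I => ?_) fun I => f (List.ofFn I)
  simp only [Finset.mem_filter, Finset.mem_univ, true_and, IsOrderedPartition, true_iff]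

/-- The ordered partition whose `j`-th block is the block `j + c` of `I`. -/
def OrderedSetPartition.rotate (I : OrderedSetPartition n (k + 1)) (c : Fin (k + 1)) :
    OrderedSetPartition n (k + 1) :=
  ⟨fun j => I.1 (j + c), fun j => I.2.1 _,
    fun j j' hne => I.2.2.1 _ _ fun h => hne (add_right_cancel h),
    fun i => by
      obtain ⟨j, hj⟩ := I.2.2.2 i
      exact ⟨j - c, show i ∈ I.1 (j - c + c) by rwa [sub_add_cancel]⟩⟩

theorem OrderedSetPartition.rotate_injective (I : OrderedSetPartition n (k + 1)) :
    Function.Injective I.rotate := by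
  intro c d h
  have hblock : I.1 c = I.1 d := by
    simpa only [rotate, zero_add] using congrFun (congrArg Subtype.val h) 0
  by_contra hne
  have hdisj := I.2.2.1 c d hne
  rw [← hblock, disjoint_self] at hdisj
  exact (I.2.1 c).ne_empty hdisj

theorem finRotate_pow_apply (t : ℕ) (j : Fin (k + 1)) :
    (finRotate (k + 1) ^ t) j = j + Fin.ofNat (k + 1) t := by
  induction t with
  | zero => simp
  | succ t ih =>
    rw [pow_succ', Equiv.Perm.mul_apply, ih, finRotate_apply, add_assoc]
    congr 1
    ext
    simp [Fin.val_add, Fin.ofNat]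

theorem OrderedSetPartition.mk_eq_mk_iff_exists_rotate {I J : OrderedSetPartition n (k + 1)} :
    (Quotient.mk _ I : CyclicSetPartition n (k + 1)) = Quotient.mk _ J ↔ ∃ c, I.rotate c = J := by
  rw [Quotient.eq]
  constructor
  · rintro ⟨t, ht⟩
    exact ⟨Fin.ofNat (k + 1) t, Subtype.ext (funext fun j => by rw [ht, finRotate_pow_apply]; rfl)⟩
  · rintro ⟨c, rfl⟩
    exact ⟨c, fun j => by rw [finRotate_pow_apply, Fin.ofNat_val_eq_self]; rfl⟩

open Classical in
theorem sum_orderedSetPartition {M : Type*} [AddCommMonoid M]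
    {f : OrderedSetPartition n (k + 1) → M} {g : CyclicSetPartition n (k + 1) → M}
    (hfg : ∀ I, ∑ c, f (I.rotate c) = g (Quotient.mk _ I)) :
    ∑ I, f I = ∑ C, g C := by
  rw [← Finset.sum_fiberwise Finset.univ
    (fun I : OrderedSetPartition n (k + 1) => (Quotient.mk _ I : CyclicSetPartition n (k + 1))) f]
  refine Finset.sum_congr rfl fun C _ => ?_
  obtain ⟨I, rfl⟩ := Quotient.exists_rep C
  have hfiber : ({J | Quotient.mk _ J = (Quotient.mk _ I : CyclicSetPartition n (k + 1))} :
      Finset (OrderedSetPartition n (k + 1))) = Finset.univ.image I.rotate := by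
    ext J
    rw [Finset.mem_filter_univ, eq_comm, OrderedSetPartition.mk_eq_mk_iff_exists_rotate]
    simp only [Finset.mem_image, Finset.mem_univ, true_and]
  rw [← hfg I, hfiber, Finset.sum_image I.rotate_injective.injOn]

end Rotation

section BlockSum

variable {n k ℓ : ℕ} {x : Fin n → ℝ}

theorem blockSum_pos (hx : ∀ i, 0 < x i) (I : OrderedSetPartition n ℓ) (j : Fin ℓ) :
    0 < I.blockSum x j :=
  Finset.sum_pos (fun i _ => hx i) (I.2.1 j)

theorem sum_blockSum (x : Fin n → ℝ) (I : OrderedSetPartition n ℓ) :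
    ∑ j, I.blockSum x j = ∑ i, x i := by
  classical
  simp only [OrderedSetPartition.blockSum]
  rw [← Finset.sum_biUnion fun j _ k _ hjk => I.2.2.1 j k hjk]
  congr 1
  ext i
  simpa using I.2.2.2 i

theorem pathIntegral_ofFn_blocks (hx : ∀ i, 0 < x i) (I : OrderedSetPartition n (k + 1)) :
    pathIntegral (blockWeight x) negHalfLine (List.ofFn I.1) 0 = linearIntegral (I.blockSum x) := by
  rw [← (integrable_and_integral_pathIntegrand (blockWeight_pos hx) isUnitWeight_negHalfLine
    I.1 0).2, linearIntegral]
  simp only [pathIntegrand, blockWeight_of_nonempty x (I.2.1 _), negHalfLine, id_eq,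
    OrderedSetPartition.blockSum]

theorem neg_cyclicSetPartition_integral_mk (hx : ∀ i, 0 < x i)
    (I : OrderedSetPartition n (k + 1)) :
    -CyclicSetPartition.integral x (Quotient.mk _ I) =
      ∑ c, (((∑ i, x i)⁻¹ * linearIntegral ((I.rotate c).blockSum x) : ℝ) : ℂ) := by
  rw [← Complex.ofReal_sum, ← Finset.mul_sum, ← sum_blockSum x I]
  exact neg_cyclicIntegral_eq (blockSum_pos hx I)

theorem sum_linearIntegral_eq (hx : ∀ i, 0 < x i) :
    (((∑ i, x i)⁻¹ * ∑ I : OrderedSetPartition n (k + 1), linearIntegral (I.blockSum x) : ℝ) : ℂ) =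
      ∑ C : CyclicSetPartition n (k + 1), -C.integral x := by
  rw [Finset.mul_sum, Complex.ofReal_sum]
  exact sum_orderedSetPartition fun I => (neg_cyclicSetPartition_integral_mk hx I).symm

end BlockSum

end

theorem mainTheorem3 (n : ℕ) (hn : 1 ≤ n) (x : Fin n → ℝ) (hx : ∀ i, 0 < x i) :
    (Integrable (buryakIntegrand n x) ∧
      buryakF n x =
        (((2 * Real.pi) ^ ((n : ℝ) / 2) / ∏ j, Real.sqrt (x j) : ℝ) : ℂ) *
          ∑ ℓ ∈ Finset.Icc 1 n, ∑ c : CyclicSetPartition n ℓ, -c.integral x) ∧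
    ∀ (ℓ : ℕ) (I : OrderedSetPartition n ℓ),
      Integrable (cyclicIntegrand (I.blockSum x)) ∧
      IntegrableOn (okounkovIntegrand fun j => I.blockSum x j / (2 : ℝ) ^ (1 / 3 : ℝ))
        {s | ∀ j, 0 ≤ s j} ∧
      cyclicIntegral (I.blockSum x) =
        (-1) ^ ℓ * (okounkovE (fun j => I.blockSum x j / (2 : ℝ) ^ (1 / 3 : ℝ)) : ℂ) := by
  refine ⟨⟨integrable_buryakIntegrand hn hx, ?_⟩, fun ℓ I => ⟨
    integrable_cyclicIntegrand (blockSum_pos hx I),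
    integrableOn_okounkovIntegrand fun j =>
      div_pos (blockSum_pos hx I j) (Real.rpow_pos_of_pos two_pos _),
    cyclicIntegral_eq_okounkovE (blockSum_pos hx I)⟩⟩
  rw [buryakF_eq hn hx, sum_pathIntegral_orderings hx, Finset.card_fin, Finset.mul_sum,
    Complex.ofReal_sum, ← Finset.Ico_add_one_right_eq_Icc, Finset.sum_Ico_eq_sum_range,
    Nat.add_sub_cancel]
  congr 1
  refine Finset.sum_congr rfl fun ℓ _ => ?_
  rw [add_comm 1 ℓ, ← sum_linearIntegral_eq hx, sumBlocks_univ]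
  simp only [pathIntegral_ofFn_blocks hx]
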